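/- Let $\alpha\in(1,2)$ and let $Z_\alpha(ds)$ be an independently scattered symmetric $\alpha$-stable ($\mathcal S\alpha\mathcal S$) random measure on $\mathbb R$ with Lebesgue control measure, defined on a probability space $(\Omega,\mathcal F,\mathbb P)$. Let $\{Z_\alpha(t):t\in\mathbb R\}$ be the associated $\mathcal S\alpha\mathcal S$ L\'evy process with c\`adl\`ag paths, i.e. a c\`adl\`ag process such that almost surely $Z_\alpha(t)=Z_\alpha((0,t])$ for each $t\ge 0$ and $Z_\alpha(t)=-Z_\alpha((t,0])$ for each $t<0$. Write $(x)_+^\kappa=x^\kappa$ if $x>0$ and $(x)_+^\kappa=0$ if $x\le 0$, let $h=\mathbf 1_{[0,1/2)}-\mathbf 1_{[1/2,1)}$, and set $$\theta(x,v)=\int_{\mathbb R}(x-s)_+^{v-1/\alpha}h(s)\,ds,\qquad \zeta_{j,k}=-2^{j/\alpha}\Big(Z_\alpha\big(\tfrac{k}{2^j}\big)-2Z_\alpha\big(\tfrac{k+1/2}{2^j}\big)+Z_\alpha\big(\tfrac{k+1}{2^j}\big)\Big),\qquad \lambda_{j,k}=\sum_{m=0}^{k}\zeta_{j,m}$$ for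 $j,k\in\mathbb Z_+$ (so that almost surely $\zeta_{j,k}=2^{j/\alpha}\int_{\mathbb R}h(2^js-k)\,Z_\alpha(ds)$), and for $J\in\mathbb N$ $$X_1^J(u,v)=\frac{u^{1+v-1/\alpha}}{1+v-1/\alpha}Z_\alpha(1)+\sum_{j=0}^{J-1}2^{-jv}\sum_{k=0}^{2^j-1}\zeta_{j,k}\,\theta(2^ju-k,v).$$ Let $\Omega_0^{**}$ be the set of those $\omega\in\Omega$ such that for every $\eta>0$ there is a finite $C(\omega)>0$ with $$|\lambda_{j,k}(\omega)|\le C(\omega)(1+j)^{1/\alpha}\log^{1/\alpha+\eta}(3+j)\,(1+k)^{1/\alpha}\log^{1/\alpha+\eta}(3+k)\qquad\text{for all } j,k\in\mathbb Z_+ .$$ Then $\Omega_0^{**}$ is an event of probability $1$. Moreover, let $a,b$ be any real numbers with $1/\alpha<a<b<1$ and let $\mathcal C=\mathcal C([0,1]\times[a,b],\mathbb R)$ carry the supremum norm $\|\cdot\|_{\mathcal C}$. Then the functions $X_1^J(\cdot,\cdot,\omega)$ belong to $\mathcal C$, and there is a random field $X_1=\{X_1(u,v):(u,v)\in[0,1]\times[a,b]\}$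 with paths in $\mathcal C$ such that, for each $\omega\in\Omega_0^{**}$, the sequence $(X_1^J(\cdot,\cdot,\omega))_{J\in\mathbb N}$ converges in $\mathcal C$ to $X_1(\cdot,\cdot,\omega)$ and, for every $\eta>0$, $$\big\|X_1(\cdot,\cdot,\omega)-X_1^J(\cdot,\cdot,\omega)\big\|_{\mathcal C}=\mathcal O\big(2^{-J(a-1/\alpha)}J^{2/\alpha+\eta}\big)\qquad (J\to+\infty).$$ Furthermore, $X_1$ is an $\mathcal S\alpha\mathcal S$ field (every finite linear combination of its values is an $\mathcal S\alpha\mathcal S$ random variable), and it is a modification of the high frequency part: for each $(u,v)\in[0,1]\times[a,b]$, almost surely, $$X_1(u,v)=\int_0^{+\infty}(u-s)_+^{v-1/\alpha}\,Z_\alpha(ds).$$ -/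

import Mathlib

open MeasureTheory ProbabilityTheory Filter Topology

namespace HaarLMSM

noncomputable section

/-- `μ` is the symmetric `α`-stable law of scale parameter `σ`. -/
def IsSaS (α σ : ℝ) (μ : Measure ℝ) : Prop :=
  ∀ t : ℝ, charFun μ t = Complex.exp (-((σ ^ α * |t| ^ α : ℝ) : ℂ))

/-- Borel sets of finite Lebesgue measure. -/
def FinBorel (A : Set ℝ) : Prop := MeasurableSet A ∧ volume A < ⊤

/-- `M` is an independently scattered symmetric `α`-stable random measure on `ℝ` with Lebesgue
control measure; only its values on Borel sets of finite Lebesgue measure matter. The series in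
`sigma_additive` is an ordinary (in general not absolutely) convergent series. -/
structure IsSaSRandomMeasure {Ω : Type*} [MeasurableSpace Ω] (P : Measure Ω) (α : ℝ)
    (M : Set ℝ → Ω → ℝ) : Prop where
  measurable : ∀ A, FinBorel A → Measurable (M A)
  law : ∀ A, FinBorel A → IsSaS α (volume.real A ^ (1 / α)) (P.map (M A))
  indep : ∀ (n : ℕ) (A : Fin n → Set ℝ), (∀ i, FinBorel (A i)) →
    Pairwise (fun i j => Disjoint (A i) (A j)) → iIndepFun (fun i => M (A i)) P
  sigma_additive : ∀ A : ℕ → Set ℝ, (∀ i, FinBorel (A i)) → volume (⋃ i, A i) < ⊤ →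
    Pairwise (fun i j => Disjoint (A i) (A j)) →
    ∀ᵐ ω ∂P, Tendsto (fun n => ∑ i ∈ Finset.range n, M (A i) ω) atTop (𝓝 (M (⋃ i, A i) ω))

/-- `Z` is the càdlàg Lévy process associated with the random measure `M`, that is, a càdlàg
version of `t ↦ M (0,t]` for `t ≥ 0`, `t ↦ -M (t,0]` for `t < 0`. -/
structure IsLevyProcessOf {Ω : Type*} [MeasurableSpace Ω] (P : Measure Ω)
    (M : Set ℝ → Ω → ℝ) (Z : ℝ → Ω → ℝ) : Prop where
  measurable : ∀ t, Measurable (Z t)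
  eq_of_nonneg : ∀ t, 0 ≤ t → ∀ᵐ ω ∂P, Z t ω = M (Set.Ioc 0 t) ω
  eq_of_neg : ∀ t, t < 0 → ∀ᵐ ω ∂P, Z t ω = -M (Set.Ioc t 0) ω
  cadlag : ∀ᵐ ω ∂P, ∀ t, ContinuousWithinAt (fun s => Z s ω) (Set.Ici t) t ∧
    ∃ l : ℝ, Tendsto (fun s => Z s ω) (𝓝[<] t) (𝓝 l)

/-- The integral `∫ g dM = ∑ c, c * M {g = c}` of a simple function. -/
def simpleIntegral {Ω : Type*} (M : Set ℝ → Ω → ℝ) (g : SimpleFunc ℝ ℝ) (ω : Ω) : ℝ :=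
  ∑ c ∈ g.range, c * M (g ⁻¹' {c}) ω

/-- `Y` is (a version of) the stochastic integral `∫ f(s) M(ds)` of `f ∈ L^α(ℝ)`: the limit in
probability of the integrals of simple functions that approximate `f` in `L^α(ℝ)`, whatever the
approximating sequence. -/
def IsStableIntegral {Ω : Type*} [MeasurableSpace Ω] (P : Measure Ω) (α : ℝ)
    (M : Set ℝ → Ω → ℝ) (f : ℝ → ℝ) (Y : Ω → ℝ) : Prop :=
  MemLp f (ENNReal.ofReal α) volume ∧ AEMeasurable Y P ∧
  ∀ g : ℕ → SimpleFunc ℝ ℝ, (∀ n, MemLp (g n) (ENNReal.ofReal α) volume) →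
    Tendsto (fun n => eLpNorm (fun s => g n s - f s) (ENNReal.ofReal α) volume) atTop (𝓝 0) →
    TendstoInMeasure P (fun n => simpleIntegral M (g n)) atTop Y

/-- `(x)_+^κ`. -/
def posPow (x κ : ℝ) : ℝ := if 0 < x then x ^ κ else 0

/-- The kernel `s ↦ 𝟙_{[0,∞)}(s) (u-s)_+^{v-1/α}` of the high frequency part. -/
def highFreqKernel (α u v : ℝ) : ℝ → ℝ :=
  Set.indicator (Set.Ici 0) (fun s => posPow (u - s) (v - 1 / α))

/-- The Haar mother wavelet. -/
def haar (s : ℝ) : ℝ :=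
  Set.indicator (Set.Ico 0 (1 / 2)) 1 s - Set.indicator (Set.Ico (1 / 2) 1) 1 s

/-- `θ(x,v) = ∫ (x-s)_+^{v-1/α} h(s) ds`. -/
def theta (α x v : ℝ) : ℝ := ∫ s : ℝ, posPow (x - s) (v - 1 / α) * haar s

/-- The Haar coefficients `ζ_{j,k} = 2^{j/α} ∫ h(2^j s - k) Z(ds)`, as increments of `Z`. -/
def zeta {Ω : Type*} (α : ℝ) (Z : ℝ → Ω → ℝ) (j k : ℕ) (ω : Ω) : ℝ :=
  -(2 : ℝ) ^ ((j : ℝ) / α) *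
    (Z ((k : ℝ) / 2 ^ j) ω - 2 * Z (((k : ℝ) + 1 / 2) / 2 ^ j) ω + Z (((k : ℝ) + 1) / 2 ^ j) ω)

/-- `λ_{j,k} = ∑_{m=0}^k ζ_{j,m}`. -/
def lam {Ω : Type*} (α : ℝ) (Z : ℝ → Ω → ℝ) (j k : ℕ) (ω : Ω) : ℝ :=
  ∑ m ∈ Finset.range (k + 1), zeta α Z j m ω

/-- The event `Ω₀**` on which, for every `η > 0`, the `λ_{j,k}` satisfy the logarithmic growth
estimate. -/
def goodEvent {Ω : Type*} (α : ℝ) (Z : ℝ → Ω → ℝ) : Set Ω :=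
  {ω | ∀ η : ℝ, 0 < η → ∃ C : ℝ, 0 < C ∧ ∀ j k : ℕ,
    |lam α Z j k ω| ≤
      C * (1 + j : ℝ) ^ (1 / α) * Real.log (3 + j) ^ (1 / α + η) *
        ((1 + k : ℝ) ^ (1 / α) * Real.log (3 + k) ^ (1 / α + η))}

/-- The Haar partial sum `X₁^J(u,v)`. -/
def partialSum {Ω : Type*} (α : ℝ) (Z : ℝ → Ω → ℝ) (J : ℕ) (u v : ℝ) (ω : Ω) : ℝ :=
  u ^ (1 + v - 1 / α) / (1 + v - 1 / α) * Z 1 ω +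
    ∑ j ∈ Finset.range J, (2 : ℝ) ^ (-(j : ℝ) * v) *
      ∑ k ∈ Finset.range (2 ^ j), zeta α Z j k ω * theta α (2 ^ j * u - k) v

/-- The rectangle `[0,1] × [a,b]`. -/
abbrev Rect (a b : ℝ) : Type := Set.Icc (0 : ℝ) 1 × Set.Icc a b

/-- `X` is a symmetric `α`-stable field: every finite linear combination of its values has a
symmetric `α`-stable law. -/
def IsSaSField {Ω T : Type*} [MeasurableSpace Ω] (P : Measure Ω) (α : ℝ) (X : T → Ω → ℝ) : Prop :=
  (∀ p, Measurable (X p)) ∧ ∀ (n : ℕ) (p : Fin n → T) (c : Fin n → ℝ),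
    ∃ σ : ℝ, 0 ≤ σ ∧ IsSaS α σ (P.map (fun ω => ∑ i, c i * X (p i) ω))

end

end HaarLMSM

open MeasureTheory ProbabilityTheory Filter Topology

namespace HaarLMSM

/-! ### Truncated powers and the function `θ` -/

/-! Convergence rests on Abel summation in `k`. The function `θ(·,v)` takes values in `[0,1]`,
vanishes on `(-∞,0]` and, by concavity of `x ↦ x^κ` with `κ = v - 1/α ≤ 1`, decreases on `[1,∞)`.
Hence its unit increments along any sequence `x, x-1, x-2, …` have absolute sum at most 3, uniformly
in `x` and `v` (`sum_abs_theta_sub_le`). The level-`j` block of the series is therefore at most `4 ·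
2^{-jv} max_{k<2^j} |λ_{j,k}|`. On the good event the maximum is `O(2^{j/α} (1+j)^{2/α+η})`, so the
blocks decay like `2^{-j(a-1/α)} (1+j)^{2/α+η}`; completeness of `𝒞` gives the limit and the tail of
the series gives the rate.

For the good event, `λ_{j,k}` is `2^{j/α}` times an alternating sum of `M` over `2(k+1)` consecutive
intervals of length `2^{-(j+1)}`. Symmetry makes the signs harmless: the sum is stable with exponent
equal to the total length. The tail bound `8s/r^α`, read off the characteristic function, and
Ottaviani's inequality control the maximum over a dyadic block of `k`. The logarithms make these
bounds summable over levels and blocks, with total `O(C^{-α})` for threshold constant `C`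
(`IsLevyProcessOf.prob_growth_le`).

For the identification, the Haar sum of level `J` is almost surely the integral of the step function
formed by the dyadic means of the kernel (`partialSum_eq_sum_dyadicMean`). The kernel is `κ`-Hölder,
so these step functions converge to it in `L^α`, and integrals of `L^α`-close simple functions are
close in probability; thus the limit is the stable integral. Linear combinations of the Haar sums
have characteristic functions `exp(-s_J |t|^α)` with `s_J` bounded, so their almost sure limits are
again symmetric stable. -/

lemma posPow_eq_max {x κ : ℝ} (hκ : 0 < κ) : posPow x κ = max x 0 ^ κ := by
  unfold posPow
  split_ifs with h
  · rw [max_eq_left h.le]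
  · rw [max_eq_right (not_lt.1 h), Real.zero_rpow hκ.ne']

lemma posPow_of_nonpos {x : ℝ} (hx : x ≤ 0) (κ : ℝ) : posPow x κ = 0 := if_neg hx.not_gt

lemma posPow_nonneg (x κ : ℝ) : 0 ≤ posPow x κ := by
  unfold posPow
  split_ifs with h
  · positivity
  · exact le_rfl

lemma posPow_mono {κ : ℝ} (hκ : 0 < κ) {x y : ℝ} (h : x ≤ y) : posPow x κ ≤ posPow y κ := by
  rw [posPow_eq_max hκ, posPow_eq_max hκ]
  gcongr

lemma posPow_le_one {κ : ℝ} (hκ : 0 < κ) {x : ℝ} (h : x ≤ 1) : posPow x κ ≤ 1 := by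
  rw [posPow_eq_max hκ]
  exact Real.rpow_le_one (le_max_right _ _) (max_le h zero_le_one) hκ.le

lemma continuous_posPow {κ : ℝ} (hκ : 0 < κ) : Continuous fun x => posPow x κ := by
  simp only [posPow_eq_max hκ]
  exact (continuous_id.max continuous_const).rpow_const fun _ => Or.inr hκ.le

lemma posPow_sub_le {κ : ℝ} (hκ : 0 < κ) (hκ' : κ ≤ 1) (x : ℝ) {h : ℝ} (hh : 0 ≤ h) :
    posPow x κ - posPow (x - h) κ ≤ h ^ κ := by
  rw [posPow_eq_max hκ, posPow_eq_max hκ, sub_le_iff_le_add]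
  calc max x 0 ^ κ ≤ (h + max (x - h) 0) ^ κ := by
        gcongr
        apply max_le
        · linarith [le_max_left (x - h) 0]
        · positivity
    _ ≤ _ := Real.rpow_add_le_add_rpow hh (le_max_right _ _) hκ.le hκ'

lemma posPow_mul_left {c : ℝ} (hc : 0 < c) (x κ : ℝ) :
    posPow (c * x) κ = c ^ κ * posPow x κ := by
  unfold posPow
  by_cases h : 0 < x
  · rw [if_pos h, if_pos (mul_pos hc h), Real.mul_rpow hc.le h.le]
  · rw [if_neg h, if_neg (by simpa [hc] using h), mul_zero]

/-- The primitive `x_+^{κ+1} / (κ+1)` of `x_+^κ`. -/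
noncomputable def posPowPrim (κ x : ℝ) : ℝ := posPow x (1 + κ) / (1 + κ)

lemma posPowPrim_of_nonpos {x : ℝ} (hx : x ≤ 0) (κ : ℝ) : posPowPrim κ x = 0 := by
  rw [posPowPrim, posPow_of_nonpos hx, zero_div]

lemma posPowPrim_mul_left {c : ℝ} (hc : 0 < c) (x κ : ℝ) :
    posPowPrim κ (c * x) = c ^ (1 + κ) * posPowPrim κ x := by
  rw [posPowPrim, posPowPrim, posPow_mul_left hc, mul_div_assoc]

lemma continuous_posPowPrim {κ : ℝ} (hκ : 0 < κ) : Continuous (posPowPrim κ) :=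
  (continuous_posPow (by linarith)).div_const _

lemma hasDerivAt_posPowPrim {κ : ℝ} (hκ : 0 < κ) (x : ℝ) :
    HasDerivAt (posPowPrim κ) (posPow x κ) x := by
  have key : ∀ y : ℝ, y ≠ 0 → HasDerivAt (posPowPrim κ) (posPow y κ) y := by
    intro y hy
    rcases lt_or_gt_of_ne hy with h | h
    · rw [posPow_of_nonpos h.le]
      refine (hasDerivAt_const y (0 : ℝ)).congr_of_eventuallyEq ?_
      filter_upwards [Iio_mem_nhds h] with z hz
      exact posPowPrim_of_nonpos (le_of_lt hz) κ
    · have h1 := (Real.hasDerivAt_rpow_const (x := y) (p := 1 + κ) (Or.inl hy)).div_const (1 + κ)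
      have h2 : (1 + κ) * y ^ (1 + κ - 1) / (1 + κ) = posPow y κ := by
        rw [posPow, if_pos h, add_sub_cancel_left]
        field_simp
      rw [h2] at h1
      refine h1.congr_of_eventuallyEq ?_
      filter_upwards [Ioi_mem_nhds h] with z hz
      rw [posPowPrim, posPow, if_pos (show 0 < z from hz)]
  -- The two local formulas do not cover 0; there the derivative is the limit of the derivatives
  -- nearby.
  by_cases hx : x = 0
  · subst hx
    exact hasDerivAt_of_hasDerivAt_of_ne (fun y hy => key y hy)
      (continuous_posPowPrim hκ).continuousAt (continuous_posPow hκ).continuousAt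
  · exact key x hx

lemma integral_posPow_sub {κ : ℝ} (hκ : 0 < κ) (u a b : ℝ) :
    ∫ s in a..b, posPow (u - s) κ = posPowPrim κ (u - a) - posPowPrim κ (u - b) := by
  have h : ∀ s ∈ Set.uIcc a b,
      HasDerivAt (fun s => -posPowPrim κ (u - s)) (posPow (u - s) κ) s := by
    intro s _
    have := ((hasDerivAt_posPowPrim hκ (u - s)).comp s ((hasDerivAt_id s).const_sub u)).fun_neg
    rw [mul_neg_one, neg_neg] at this
    exact this
  rw [intervalIntegral.integral_eq_sub_of_hasDerivAt h]
  · ring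
  · exact ((continuous_posPow hκ).comp (continuous_const.sub continuous_id)).intervalIntegrable _ _

lemma posPowPrim_sub_le {κ : ℝ} (hκ : 0 < κ) (x : ℝ) {h : ℝ} (hh : 0 ≤ h) :
    posPowPrim κ x - posPowPrim κ (x - h) ≤ h * posPow x κ := by
  have := integral_posPow_sub hκ x 0 h
  rw [sub_zero] at this
  rw [← this]
  calc ∫ s in (0 : ℝ)..h, posPow (x - s) κ ≤ ∫ s in (0 : ℝ)..h, posPow x κ := by
        apply intervalIntegral.integral_mono_on hh
        · exact ((continuous_posPow hκ).comp
            (continuous_const.sub continuous_id)).intervalIntegrable _ _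
        · exact continuous_const.intervalIntegrable _ _
        · intro s hs
          exact posPow_mono hκ (by linarith [hs.1])
    _ = _ := by simp

lemma le_posPowPrim_sub {κ : ℝ} (hκ : 0 < κ) (x : ℝ) {h : ℝ} (hh : 0 ≤ h) :
    h * posPow (x - h) κ ≤ posPowPrim κ x - posPowPrim κ (x - h) := by
  have := integral_posPow_sub hκ x 0 h
  rw [sub_zero] at this
  rw [← this]
  calc h * posPow (x - h) κ = ∫ s in (0 : ℝ)..h, posPow (x - h) κ := by simp
    _ ≤ ∫ s in (0 : ℝ)..h, posPow (x - s) κ := by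
        apply intervalIntegral.integral_mono_on hh
        · exact continuous_const.intervalIntegrable _ _
        · exact ((continuous_posPow hκ).comp
            (continuous_const.sub continuous_id)).intervalIntegrable _ _
        · intro s hs
          exact posPow_mono hκ (by linarith [hs.2])

section Theta

variable {α v : ℝ}

lemma theta_eq_intervalIntegral (hv : 1 / α < v) (x : ℝ) :
    theta α x v = (∫ s in (0 : ℝ)..(1 / 2), posPow (x - s) (v - 1 / α)) -
      ∫ s in (1 / 2 : ℝ)..1, posPow (x - s) (v - 1 / α) := by
  have hκ : 0 < v - 1 / α := sub_pos.2 hv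
  have hc : Continuous fun s => posPow (x - s) (v - 1 / α) :=
    (continuous_posPow hκ).comp (continuous_const.sub continuous_id)
  have hi : ∀ a b : ℝ, IntegrableOn (fun s => posPow (x - s) (v - 1 / α)) (Set.Ico a b) :=
    fun a b => (hc.integrableOn_Icc (a := a) (b := b)).mono_set Set.Ico_subset_Icc_self
  have e : (fun s => posPow (x - s) (v - 1 / α) * haar s) = fun s =>
      Set.indicator (Set.Ico 0 (1 / 2)) (fun s => posPow (x - s) (v - 1 / α)) s -
      Set.indicator (Set.Ico (1 / 2) 1) (fun s => posPow (x - s) (v - 1 / α)) s := by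
    funext s
    simp only [haar, Set.indicator_apply, Pi.one_apply, mul_sub, mul_ite, mul_one, mul_zero]
  rw [theta, e, integral_sub ((integrable_indicator_iff measurableSet_Ico).2 (hi _ _))
    ((integrable_indicator_iff measurableSet_Ico).2 (hi _ _)),
    integral_indicator measurableSet_Ico, integral_indicator measurableSet_Ico,
    integral_Ico_eq_integral_Ioc, integral_Ico_eq_integral_Ioc,
    intervalIntegral.integral_of_le (by norm_num), intervalIntegral.integral_of_le (by norm_num)]

lemma theta_eq_posPowPrim (hv : 1 / α < v) (x : ℝ) :
    theta α x v = posPowPrim (v - 1 / α) x - 2 * posPowPrim (v - 1 / α) (x - 1 / 2) +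
      posPowPrim (v - 1 / α) (x - 1) := by
  rw [theta_eq_intervalIntegral hv, integral_posPow_sub (sub_pos.2 hv),
    integral_posPow_sub (sub_pos.2 hv), sub_zero]
  ring

/-- Pairing `s` with `s + 1/2` turns `θ` into an integral of increments of the truncated power, from
which sign, size and monotonicity can be read pointwise. -/
lemma theta_eq_integral_sub (hv : 1 / α < v) (x : ℝ) :
    theta α x v = ∫ s in (0 : ℝ)..(1 / 2),
      (posPow (x - s) (v - 1 / α) - posPow (x - s - 1 / 2) (v - 1 / α)) := by
  have hc : Continuous fun s => posPow s (v - 1 / α) := continuous_posPow (sub_pos.2 hv)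
  have h1 : IntervalIntegrable (fun s => posPow (x - s) (v - 1 / α)) volume 0 (1 / 2) :=
    (hc.comp (by fun_prop : Continuous fun s => x - s)).intervalIntegrable _ _
  have h2 : IntervalIntegrable (fun s => posPow (x - s - 1 / 2) (v - 1 / α)) volume 0 (1 / 2) :=
    (hc.comp (by fun_prop : Continuous fun s => x - s - 1 / 2)).intervalIntegrable _ _
  rw [theta_eq_intervalIntegral hv, intervalIntegral.integral_sub h1 h2]
  congr 1
  have := intervalIntegral.integral_comp_add_right (a := 0) (b := 1 / 2)
    (fun s => posPow (x - s) (v - 1 / α)) (1 / 2)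
  rw [zero_add, add_halves] at this
  rw [← this]
  refine intervalIntegral.integral_congr fun s _ => ?_
  congr 1
  ring

lemma theta_of_nonpos (hv : 1 / α < v) {x : ℝ} (hx : x ≤ 0) : theta α x v = 0 := by
  rw [theta_eq_posPowPrim hv, posPowPrim_of_nonpos hx, posPowPrim_of_nonpos (by linarith),
    posPowPrim_of_nonpos (by linarith)]
  ring

lemma theta_nonneg (hv : 1 / α < v) (x : ℝ) : 0 ≤ theta α x v := by
  rw [theta_eq_integral_sub hv]
  refine intervalIntegral.integral_nonneg (by norm_num) fun s _ => ?_
  exact sub_nonneg.2 (posPow_mono (sub_pos.2 hv) (by linarith))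

lemma theta_le_one (hv : 1 / α < v) (hv' : v - 1 / α ≤ 1) (x : ℝ) : theta α x v ≤ 1 := by
  have hκ : 0 < v - 1 / α := sub_pos.2 hv
  have hc : Continuous fun s => posPow s (v - 1 / α) := continuous_posPow hκ
  rw [theta_eq_integral_sub hv]
  calc _ ≤ ∫ s in (0 : ℝ)..(1 / 2), (1 : ℝ) := by
        apply intervalIntegral.integral_mono_on (by norm_num)
        · exact ((hc.comp (by fun_prop : Continuous fun s => x - s)).sub
            (hc.comp (by fun_prop : Continuous fun s => x - s - 1 / 2))).intervalIntegrable _ _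
        · exact continuous_const.intervalIntegrable _ _
        · intro s _
          refine (posPow_sub_le hκ hv' (x - s) (by norm_num : (0 : ℝ) ≤ 1 / 2)).trans ?_
          exact Real.rpow_le_one (by norm_num) (by norm_num) hκ.le
    _ ≤ 1 := by simp; norm_num

/-- Both `x + h` and `y` are convex combinations of `x` and `y + h`, with complementary weights;
adding the two concavity inequalities gives the claim. -/
lemma rpow_sub_rpow_antitone {κ : ℝ} (hκ : 0 < κ) (hκ' : κ ≤ 1) {x y h : ℝ} (hx : 0 ≤ x)
    (hxy : x ≤ y) (hh : 0 ≤ h) : (y + h) ^ κ - y ^ κ ≤ (x + h) ^ κ - x ^ κ := by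
  rcases eq_or_lt_of_le hxy with rfl | hxy
  · exact le_rfl
  have hD : 0 < y + h - x := by linarith
  have hc := (Real.concaveOn_rpow hκ.le hκ').2
  set t := h / (y + h - x) with ht
  have ht0 : 0 ≤ t := by positivity
  have ht1 : t ≤ 1 := by rw [ht, div_le_one hD]; linarith
  have htD : t * (y + h - x) = h := div_mul_cancel₀ _ hD.ne'
  have h1 := hc (x := x) (y := y + h) hx (show 0 ≤ y + h by linarith) (sub_nonneg.2 ht1) ht0
    (by ring)
  have h2 := hc (x := x) (y := y + h) hx (show 0 ≤ y + h by linarith) ht0 (sub_nonneg.2 ht1)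
    (by ring)
  simp only [smul_eq_mul] at h1 h2
  have e1 : (1 - t) * x + t * (y + h) = x + h := by linear_combination htD
  have e2 : t * x + (1 - t) * (y + h) = y := by linear_combination -htD
  rw [e1] at h1
  rw [e2] at h2
  linarith

/-- For `x ≥ 1` and `s ≤ 1/2` no truncation is active, so the integrand is an increment of a concave
power. -/
lemma theta_antitoneOn (hv : 1 / α < v) (hv' : v - 1 / α ≤ 1) :
    AntitoneOn (fun x => theta α x v) (Set.Ici 1) := by
  intro x hx y _ hxy
  have hκ : 0 < v - 1 / α := sub_pos.2 hv
  have hc : Continuous fun s => posPow s (v - 1 / α) := continuous_posPow hκ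
  have hI : ∀ z, IntervalIntegrable (fun s => posPow (z - s) (v - 1 / α) -
      posPow (z - s - 1 / 2) (v - 1 / α)) volume 0 (1 / 2) := fun z =>
    ((hc.comp (by fun_prop : Continuous fun s => z - s)).sub
      (hc.comp (by fun_prop : Continuous fun s => z - s - 1 / 2))).intervalIntegrable _ _
  simp only [theta_eq_integral_sub hv]
  refine intervalIntegral.integral_mono_on (by norm_num) (hI y) (hI x) fun s hs => ?_
  have hx1 : (1 : ℝ) ≤ x := hx
  have hs2 := hs.2
  have hx2 : 0 ≤ x - s - 1 / 2 := by linarith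
  have := rpow_sub_rpow_antitone hκ hv' hx2 (show x - s - 1 / 2 ≤ y - s - 1 / 2 by linarith)
    (by norm_num : (0 : ℝ) ≤ 1 / 2)
  rw [sub_add_cancel, sub_add_cancel] at this
  rwa [posPow_eq_max hκ, posPow_eq_max hκ, posPow_eq_max hκ, posPow_eq_max hκ,
    max_eq_left, max_eq_left, max_eq_left, max_eq_left] <;> linarith

/-- A bounded increasing function whose increments over unit steps dominate those of `θ`. -/
noncomputable def thetaMajorant (α v x : ℝ) : ℝ :=
  if x ≤ 0 then 0 else if x < 1 then 1 else 3 - theta α x v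

/-- The majorant takes values 0, then 1, then at least 2. It thus gains at least 1, the largest
possible change of `θ`, when `x` crosses into `(0,1)` or into `[1,2)`; beyond that its increments
are exactly those of `-θ`. -/
lemma abs_theta_sub_le (hv : 1 / α < v) (hv' : v - 1 / α ≤ 1) (x : ℝ) :
    |theta α x v - theta α (x - 1) v| ≤ thetaMajorant α v x - thetaMajorant α v (x - 1) := by
  have h0 := theta_nonneg hv x
  have h1 := theta_le_one hv hv' x
  have h2 := theta_nonneg hv (x - 1)
  have h3 := theta_le_one hv hv' (x - 1)
  unfold thetaMajorant
  by_cases hx : x ≤ 0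
  · rw [if_pos hx, if_pos (by linarith), theta_of_nonpos hv hx, theta_of_nonpos hv (by linarith)]
    simp
  rw [if_neg hx]
  by_cases hx1 : x < 1
  · rw [if_pos hx1, if_pos (by linarith), theta_of_nonpos hv (by linarith : x - 1 ≤ 0)]
    rw [abs_of_nonneg] <;> linarith
  rw [if_neg hx1]
  have hle : |theta α x v - theta α (x - 1) v| ≤ 1 := abs_le.2 ⟨by linarith, by linarith⟩
  by_cases hx2 : x - 1 < 1
  · split_ifs <;> linarith
  · rw [if_neg (by linarith), if_neg hx2]
    have := theta_antitoneOn hv hv' (show x - 1 ∈ Set.Ici 1 by simpa using hx2)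
      (show x ∈ Set.Ici 1 by simpa using hx1) (by linarith)
    dsimp only at this
    rw [abs_of_nonpos] <;> linarith

lemma sum_abs_theta_sub_le (hv : 1 / α < v) (hv' : v - 1 / α ≤ 1) (x : ℝ) (n : ℕ) :
    ∑ k ∈ Finset.range n, |theta α (x - (k + 1 : ℕ)) v - theta α (x - k) v| ≤ 3 := by
  have hb : ∀ y, 0 ≤ thetaMajorant α v y ∧ thetaMajorant α v y ≤ 3 := by
    intro y
    have h0 := theta_nonneg hv y
    have h1 := theta_le_one hv hv' y
    unfold thetaMajorant
    split_ifs <;> constructor <;> linarith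
  calc _ ≤ ∑ k ∈ Finset.range n,
        (thetaMajorant α v (x - k) - thetaMajorant α v (x - (k + 1 : ℕ))) := by
        refine Finset.sum_le_sum fun k _ => ?_
        rw [abs_sub_comm]
        have := abs_theta_sub_le hv hv' (x - k)
        rwa [sub_sub, ← Nat.cast_add_one] at this
    _ = thetaMajorant α v x - thetaMajorant α v (x - n) := by
        rw [Finset.sum_range_sub' (fun k : ℕ => thetaMajorant α v (x - k))]
        simp
    _ ≤ 3 := by linarith [(hb x).2, (hb (x - n)).1]

lemma continuousOn_theta :
    ContinuousOn (fun q : ℝ × ℝ => theta α q.1 q.2) {q | 1 / α < q.2} := by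
  have hF : ∀ c : ℝ, ContinuousOn (fun q : ℝ × ℝ => posPowPrim (q.2 - 1 / α) (q.1 - c))
      {q | 1 / α < q.2} := by
    intro c
    have : ContinuousOn (fun q : ℝ × ℝ => max (q.1 - c) 0 ^ (1 + (q.2 - 1 / α)) /
        (1 + (q.2 - 1 / α))) {q | 1 / α < q.2} := by
      refine ContinuousOn.div (ContinuousOn.rpow (by fun_prop) (by fun_prop) ?_) (by fun_prop) ?_
      · intro q hq
        have : 1 / α < q.2 := hq
        right
        linarith
      · intro q hq
        have : 1 / α < q.2 := hq
        linarith
    refine this.congr fun q hq => ?_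
    have : 1 / α < q.2 := hq
    rw [posPowPrim, posPow_eq_max (by linarith)]
  have h := ((hF 0).sub (continuousOn_const.mul (hF (1 / 2)) :
    ContinuousOn (fun q : ℝ × ℝ => (2 : ℝ) * _) _)).add (hF 1)
  refine h.congr fun q hq => ?_
  simp only [Pi.add_apply, Pi.sub_apply, sub_zero]
  exact theta_eq_posPowPrim hq _

end Theta

/-! ### Haar partial sums as integrals of step functions -/

/-- The mean of `s ↦ (u-s)_+^κ` over the dyadic interval `(k/2^J, (k+1)/2^J]`. -/
noncomputable def dyadicMean (κ u : ℝ) (J k : ℕ) : ℝ :=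
  2 ^ J * (posPowPrim κ (u - k / 2 ^ J) - posPowPrim κ (u - (k + 1) / 2 ^ J))

lemma dyadicMean_le {κ : ℝ} (hκ : 0 < κ) (u : ℝ) (J k : ℕ) :
    dyadicMean κ u J k ≤ posPow (u - k / 2 ^ J) κ := by
  have h := posPowPrim_sub_le hκ (u - k / 2 ^ J) (by positivity : (0 : ℝ) ≤ 1 / 2 ^ J)
  have e : u - (k : ℝ) / 2 ^ J - 1 / 2 ^ J = u - (k + 1) / 2 ^ J := by ring
  rw [e] at h
  calc dyadicMean κ u J k ≤ 2 ^ J * (1 / 2 ^ J * posPow (u - k / 2 ^ J) κ) := by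
        unfold dyadicMean
        gcongr
    _ = _ := by field_simp

lemma le_dyadicMean {κ : ℝ} (hκ : 0 < κ) (u : ℝ) (J k : ℕ) :
    posPow (u - (k + 1) / 2 ^ J) κ ≤ dyadicMean κ u J k := by
  have h := le_posPowPrim_sub hκ (u - k / 2 ^ J) (by positivity : (0 : ℝ) ≤ 1 / 2 ^ J)
  have e : u - (k : ℝ) / 2 ^ J - 1 / 2 ^ J = u - (k + 1) / 2 ^ J := by ring
  rw [e] at h
  calc _ = 2 ^ J * (1 / 2 ^ J * posPow (u - (k + 1) / 2 ^ J) κ) := by field_simp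
    _ ≤ dyadicMean κ u J k := by
        unfold dyadicMean
        gcongr

lemma abs_dyadicMean_le_one {κ : ℝ} (hκ : 0 < κ) {u : ℝ} (hu : u ≤ 1) (J k : ℕ) :
    |dyadicMean κ u J k| ≤ 1 := by
  rw [abs_of_nonneg ((posPow_nonneg _ _).trans (le_dyadicMean hκ u J k))]
  refine (dyadicMean_le hκ u J k).trans (posPow_le_one hκ ?_)
  have : (0 : ℝ) ≤ k / 2 ^ J := by positivity
  linarith

/-- Both the mean and the value lie between the values at the endpoints, whose gap is bounded by
subadditivity of `t ↦ t^κ`. -/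
lemma abs_dyadicMean_sub_le {κ : ℝ} (hκ : 0 < κ) (hκ' : κ ≤ 1) (u : ℝ) {J k : ℕ} {s : ℝ}
    (hs : s ∈ Set.Ioc ((k : ℝ) / 2 ^ J) ((k + 1) / 2 ^ J)) :
    |dyadicMean κ u J k - posPow (u - s) κ| ≤ (1 / 2 ^ J) ^ κ := by
  have h1 := dyadicMean_le hκ u J k
  have h2 := le_dyadicMean hκ u J k
  have h3 : posPow (u - (k + 1) / 2 ^ J) κ ≤ posPow (u - s) κ :=
    posPow_mono hκ (by linarith [hs.2])
  have h4 : posPow (u - s) κ ≤ posPow (u - k / 2 ^ J) κ := posPow_mono hκ (by linarith [hs.1])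
  have h5 := posPow_sub_le hκ hκ' (u - k / 2 ^ J) (by positivity : (0 : ℝ) ≤ 1 / 2 ^ J)
  have e : u - (k : ℝ) / 2 ^ J - 1 / 2 ^ J = u - (k + 1) / 2 ^ J := by ring
  rw [e] at h5
  exact abs_le.2 ⟨by linarith, by linarith⟩

/-- Homogeneity of the primitive makes all powers of 2 collapse to `2^J`. The result is half the
difference between the level-`J+1` means on the two halves of the `k`-th interval. -/
lemma theta_scale {α v : ℝ} (hv : 1 / α < v) (u : ℝ) (J k : ℕ) :
    (2 : ℝ) ^ (-(J : ℝ) * v) * (2 : ℝ) ^ ((J : ℝ) / α) * theta α (2 ^ J * u - k) v =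
      2 ^ J * (posPowPrim (v - 1 / α) (u - k / 2 ^ J) -
        2 * posPowPrim (v - 1 / α) (u - (k + 1 / 2) / 2 ^ J) +
        posPowPrim (v - 1 / α) (u - (k + 1) / 2 ^ J)) := by
  have hp : (0 : ℝ) < 2 ^ J := by positivity
  rw [theta_eq_posPowPrim hv]
  have e1 : (2 : ℝ) ^ J * u - k = 2 ^ J * (u - k / 2 ^ J) := by field_simp
  have e2 : (2 : ℝ) ^ J * u - k - 1 / 2 = 2 ^ J * (u - (k + 1 / 2) / 2 ^ J) := by
    field_simp; ring
  have e3 : (2 : ℝ) ^ J * u - k - 1 = 2 ^ J * (u - (k + 1) / 2 ^ J) := by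
    field_simp; ring
  rw [e2, e3, e1, posPowPrim_mul_left hp, posPowPrim_mul_left hp, posPowPrim_mul_left hp]
  have e4 : (2 : ℝ) ^ (-(J : ℝ) * v) * (2 : ℝ) ^ ((J : ℝ) / α) *
      ((2 : ℝ) ^ J) ^ (1 + (v - 1 / α)) = 2 ^ J := by
    rw [← Real.rpow_natCast 2 J, ← Real.rpow_mul (by norm_num), ← Real.rpow_add (by norm_num),
      ← Real.rpow_add (by norm_num)]
    congr 1
    ring
  linear_combination (posPowPrim (v - 1 / α) (u - k / 2 ^ J) -
        2 * posPowPrim (v - 1 / α) (u - (k + 1 / 2) / 2 ^ J) +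
        posPowPrim (v - 1 / α) (u - (k + 1) / 2 ^ J)) * e4

lemma sum_range_two_mul {β : Type*} [AddCommMonoid β] (f : ℕ → β) (n : ℕ) :
    ∑ i ∈ Finset.range (2 * n), f i = ∑ k ∈ Finset.range n, (f (2 * k) + f (2 * k + 1)) := by
  induction n with
  | zero => simp
  | succ n ih =>
    rw [Finset.sum_range_succ, ← ih, mul_add, mul_one, Finset.sum_range_succ,
      Finset.sum_range_succ, add_assoc]

/-- A Haar partial sum is the sum of the increments of `Z` weighted by the dyadic means. -/
lemma partialSum_eq_sum_dyadicMean {Ω : Type*} {α u v : ℝ} (hv : 1 / α < v)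
    (hu : 0 ≤ u) (hu' : u ≤ 1) (Z : ℝ → Ω → ℝ) (ω : Ω) (h0 : Z 0 ω = 0) (J : ℕ) :
    partialSum α Z J u v ω = ∑ k ∈ Finset.range (2 ^ J), dyadicMean (v - 1 / α) u J k *
      (Z (((k : ℝ) + 1) / 2 ^ J) ω - Z ((k : ℝ) / 2 ^ J) ω) := by
  induction J with
  | zero =>
    have e : (1 : ℝ) + v - 1 / α = 1 + (v - 1 / α) := by ring
    have : posPowPrim (v - 1 / α) u = u ^ (1 + v - 1 / α) / (1 + v - 1 / α) := by
      rw [posPowPrim, posPow_eq_max (by linarith), max_eq_left hu, e]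
    -- The normalization `Z 0 = 0` enters only here, and `u ≤ 1` kills the primitive at `u - 1`.
    simp only [partialSum, dyadicMean, ← this, pow_zero, Finset.range_zero, Finset.sum_empty,
      Finset.range_one, Finset.sum_singleton, Nat.cast_zero, h0, zero_add, div_one,
      posPowPrim_of_nonpos (show u - 1 ≤ 0 by linarith)]
    ring_nf
  | succ J ih =>
    have hs : partialSum α Z (J + 1) u v ω = partialSum α Z J u v ω +
        (2 : ℝ) ^ (-(J : ℝ) * v) *
        ∑ k ∈ Finset.range (2 ^ J), zeta α Z J k ω * theta α (2 ^ J * u - k) v := by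
      rw [partialSum, partialSum, Finset.sum_range_succ, add_assoc]
    rw [hs, ih, pow_succ', sum_range_two_mul, Finset.mul_sum, ← Finset.sum_add_distrib]
    refine Finset.sum_congr rfl fun k _ => ?_
    have hth := theta_scale hv u J k
    have e1 : ((2 * k : ℕ) : ℝ) / 2 ^ (J + 1) = k / 2 ^ J := by
      push_cast; rw [pow_succ']; field_simp
    have e2 : (((2 * k : ℕ) : ℝ) + 1) / 2 ^ (J + 1) = (k + 1 / 2) / 2 ^ J := by
      push_cast; rw [pow_succ']; field_simp
    have e3 : ((2 * k + 1 : ℕ) : ℝ) / 2 ^ (J + 1) = (k + 1 / 2) / 2 ^ J := by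
      push_cast; rw [pow_succ']; field_simp
    have e4 : (((2 * k + 1 : ℕ) : ℝ) + 1) / 2 ^ (J + 1) = (k + 1) / 2 ^ J := by
      push_cast; rw [pow_succ']; field_simp; ring
    simp only [dyadicMean, zeta, e1, e2, e3, e4]
    rw [pow_succ']
    -- With child means `D₀, D₁` and child increments `z₀, z₁`, this is `D₀z₀ + D₁z₁ = (D₀+D₁)/2 ·
    -- (z₀+z₁) + (D₀-D₁)/2 · (z₀-z₁)`: the parent term plus the Haar term.
    linear_combination (-(Z ((k : ℝ) / 2 ^ J) ω - 2 * Z (((k : ℝ) + 1 / 2) / 2 ^ J) ω +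
      Z (((k : ℝ) + 1) / 2 ^ J) ω)) * hth

/-! ### Convergence of the Haar partial sums on the good event -/

/-- Abel summation: the boundary term costs `B` and the increments of `t` cost `B V`. -/
lemma abs_sum_mul_le_of_partial_sums {n : ℕ} {z t : ℕ → ℝ} {B V : ℝ}
    (hB : ∀ k < n, |∑ m ∈ Finset.range (k + 1), z m| ≤ B) (hB0 : 0 ≤ B)
    (ht : ∀ k, |t k| ≤ 1) (hV : ∀ m, ∑ k ∈ Finset.range m, |t (k + 1) - t k| ≤ V) :
    |∑ k ∈ Finset.range n, z k * t k| ≤ B * (1 + V) := by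
  rcases Nat.eq_zero_or_pos n with rfl | hn
  · have := hV 0
    simp only [Finset.range_zero, Finset.sum_empty, abs_zero] at this ⊢
    positivity
  obtain ⟨m, rfl⟩ := Nat.exists_eq_add_of_le' hn
  have h := Finset.sum_range_by_parts t z (m + 1)
  simp only [smul_eq_mul, Nat.add_sub_cancel] at h
  simp only [mul_comm (z _)]
  rw [h]
  calc _ ≤ |t m * ∑ i ∈ Finset.range (m + 1), z i| +
        |∑ i ∈ Finset.range m, (t (i + 1) - t i) * ∑ i ∈ Finset.range (i + 1), z i| := abs_sub _ _
    _ ≤ B + V * B := by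
        gcongr
        · rw [abs_mul]
          calc _ ≤ 1 * B := mul_le_mul (ht m) (hB m (by omega)) (abs_nonneg _) zero_le_one
            _ = B := one_mul B
        · refine (Finset.abs_sum_le_sum_abs _ _).trans ?_
          calc _ ≤ ∑ i ∈ Finset.range m, |t (i + 1) - t i| * B := by
                refine Finset.sum_le_sum fun i hi => ?_
                rw [abs_mul]
                exact mul_le_mul_of_nonneg_left
                  (hB i ((Finset.mem_range.1 hi).trans (Nat.lt_succ_self m))) (abs_nonneg _)
            _ ≤ V * B := by
                rw [← Finset.sum_mul]
                exact mul_le_mul_of_nonneg_right (hV m) hB0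
    _ = B * (1 + V) := by ring

lemma exists_log_rpow_le {q ε : ℝ} (hq : 0 < q) (hε : 0 < ε) :
    ∃ K : ℝ, 0 < K ∧ ∀ j : ℕ, Real.log (3 + j) ^ q ≤ K * (1 + j : ℝ) ^ ε := by
  have hd : 0 < ε / q := by positivity
  refine ⟨(3 ^ (ε / q) / (ε / q)) ^ q, by positivity, fun j => ?_⟩
  have h1 : Real.log (3 + j) ≤ 3 ^ (ε / q) / (ε / q) * (1 + j : ℝ) ^ (ε / q) := by
    calc Real.log (3 + j) ≤ Real.log (3 * (1 + j)) := by
          apply Real.log_le_log (by positivity)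
          have : (0 : ℝ) ≤ j := by positivity
          linarith
      _ ≤ (3 * (1 + j : ℝ)) ^ (ε / q) / (ε / q) := Real.log_le_rpow_div (by positivity) hd
      _ = _ := by rw [Real.mul_rpow (by norm_num) (by positivity)]; ring
  calc Real.log (3 + j) ^ q ≤ (3 ^ (ε / q) / (ε / q) * (1 + j : ℝ) ^ (ε / q)) ^ q := by
        apply Real.rpow_le_rpow (Real.log_nonneg _) h1 hq.le
        have : (0 : ℝ) ≤ j := by positivity
        linarith
    _ = _ := by
        rw [Real.mul_rpow (by positivity) (by positivity), ← Real.rpow_mul (by positivity) (ε / q),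
          div_mul_cancel₀ _ hq.ne']

lemma log_three_add_two_pow_le (j : ℕ) : Real.log (3 + 2 ^ j) ≤ 2 * (1 + j) := by
  have h1 : (3 : ℝ) + 2 ^ j ≤ 2 ^ (j + 2) := by
    have : (1 : ℝ) ≤ 2 ^ j := one_le_pow₀ (by norm_num)
    rw [pow_add]
    linarith
  have h2 := Real.log_le_log (by positivity) h1
  rw [Real.log_pow] at h2
  have h3 := Real.log_two_lt_d9
  have h4 := Real.log_pos one_lt_two
  push_cast at h2
  have : (0 : ℝ) ≤ j := by positivity
  nlinarith

/-- On the good event, the `λ_{j,k}` with `k < 2^j` grow at most like `2^{j/α} j^{2/α+η}`. -/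
lemma exists_abs_lam_le {Ω : Type*} {α : ℝ} (hα : 0 < α) {Z : ℝ → Ω → ℝ} {ω : Ω}
    (hω : ω ∈ goodEvent α Z) {η : ℝ} (hη : 0 < η) :
    ∃ C : ℝ, 0 < C ∧ ∀ j k : ℕ, k < 2 ^ j →
      |lam α Z j k ω| ≤ C * ((2 : ℝ) ^ ((j : ℝ) / α) * (1 + j : ℝ) ^ (2 / α + η)) := by
  -- Halving `η` balances the exponents of `1+j`: `1/α` is explicit, `η/2` absorbs `log (3+j)`, and
  -- `1/α + η/2` comes from `log (3+k) ≤ 2(1+j)`. They add up to `2/α + η`.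
  obtain ⟨C, hC, h⟩ := hω (η / 2) (by positivity)
  have hα' : 0 < 1 / α := by positivity
  have hq : 0 < 1 / α + η / 2 := by positivity
  obtain ⟨K, hK, hlog⟩ := exists_log_rpow_le hq (half_pos hη)
  refine ⟨C * K * 2 ^ (1 / α + η / 2), by positivity, fun j k hk => (h j k).trans ?_⟩
  have hk1 : (1 + k : ℝ) ≤ 2 ^ j := by
    have : k + 1 ≤ 2 ^ j := hk
    have : ((k + 1 : ℕ) : ℝ) ≤ ((2 ^ j : ℕ) : ℝ) := by exact_mod_cast this
    push_cast at this
    linarith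
  have e1 : (1 + k : ℝ) ^ (1 / α) ≤ (2 : ℝ) ^ ((j : ℝ) / α) := by
    calc (1 + k : ℝ) ^ (1 / α) ≤ ((2 : ℝ) ^ j) ^ (1 / α) := by gcongr
      _ = _ := by
        rw [← Real.rpow_natCast, ← Real.rpow_mul (by norm_num), mul_one_div]
  have e2 : Real.log (3 + k) ^ (1 / α + η / 2) ≤
      2 ^ (1 / α + η / 2) * (1 + j : ℝ) ^ (1 / α + η / 2) := by
    rw [← Real.mul_rpow (by norm_num) (by positivity)]
    have hk0 : (0 : ℝ) ≤ k := by positivity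
    refine Real.rpow_le_rpow (Real.log_nonneg (by linarith)) ?_ hq.le
    refine le_trans (Real.log_le_log (by positivity) ?_) (log_three_add_two_pow_le j)
    linarith
  have hlog0 : 0 ≤ Real.log (3 + j) ^ (1 / α + η / 2) := by
    apply Real.rpow_nonneg
    apply Real.log_nonneg
    have : (0 : ℝ) ≤ j := by positivity
    linarith
  have hlog1 : 0 ≤ Real.log (3 + k) ^ (1 / α + η / 2) := by
    apply Real.rpow_nonneg
    apply Real.log_nonneg
    have : (0 : ℝ) ≤ k := by positivity
    linarith
  calc _ ≤ C * (1 + j : ℝ) ^ (1 / α) * (K * (1 + j : ℝ) ^ (η / 2)) *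
        ((2 : ℝ) ^ ((j : ℝ) / α) * (2 ^ (1 / α + η / 2) * (1 + j : ℝ) ^ (1 / α + η / 2))) := by
        have := hlog j
        gcongr
    _ = _ := by
        have : (1 + j : ℝ) ^ (2 / α + η) = (1 + j : ℝ) ^ (1 / α) * (1 + j : ℝ) ^ (η / 2) *
            (1 + j : ℝ) ^ (1 / α + η / 2) := by
          rw [← Real.rpow_add (by positivity), ← Real.rpow_add (by positivity)]
          congr 1
          ring
        rw [this]
        ring

/-- Abel summation against `λ_{j,k}` gives the factor `1 + 3`; the worst exponent on the rectangle
is `v = a`. -/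
lemma exists_abs_partialSum_sub_le {Ω : Type*} {α : ℝ} (hα : 1 < α) {Z : ℝ → Ω → ℝ} {ω : Ω}
    (hω : ω ∈ goodEvent α Z) {a b : ℝ} (ha : 1 / α < a) (hb : b < 1) {η : ℝ} (hη : 0 < η) :
    ∃ C : ℝ, 0 < C ∧ ∀ (j : ℕ) (u v : ℝ), v ∈ Set.Icc a b →
      |partialSum α Z (j + 1) u v ω - partialSum α Z j u v ω| ≤
        C * ((2 : ℝ) ^ (-(j : ℝ) * (a - 1 / α)) * (1 + j : ℝ) ^ (2 / α + η)) := by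
  have hα0 : 0 < α := by linarith
  obtain ⟨C, hC, h⟩ := exists_abs_lam_le hα0 hω hη
  refine ⟨C * 4, by positivity, fun j u v hv => ?_⟩
  have hv1 : 1 / α < v := ha.trans_le hv.1
  have hv2 : v - 1 / α ≤ 1 := by
    have : 0 < 1 / α := by positivity
    linarith [hv.2]
  have e : partialSum α Z (j + 1) u v ω - partialSum α Z j u v ω = (2 : ℝ) ^ (-(j : ℝ) * v) *
      ∑ k ∈ Finset.range (2 ^ j), zeta α Z j k ω * theta α (2 ^ j * u - k) v := by
    rw [partialSum, partialSum, Finset.sum_range_succ]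
    ring
  rw [e, abs_mul, abs_of_nonneg (by positivity)]
  have hθ : ∀ k : ℕ, |theta α (2 ^ j * u - k) v| ≤ 1 := fun k => by
    rw [abs_of_nonneg (theta_nonneg hv1 _)]
    exact theta_le_one hv1 hv2 _
  have hsum : |∑ k ∈ Finset.range (2 ^ j), zeta α Z j k ω * theta α (2 ^ j * u - k) v| ≤
      C * ((2 : ℝ) ^ ((j : ℝ) / α) * (1 + j : ℝ) ^ (2 / α + η)) * (1 + 3) :=
    abs_sum_mul_le_of_partial_sums (h j) (by positivity) hθ
      (sum_abs_theta_sub_le hv1 hv2 (2 ^ j * u))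
  calc _ ≤ (2 : ℝ) ^ (-(j : ℝ) * a) *
        (C * ((2 : ℝ) ^ ((j : ℝ) / α) * (1 + j : ℝ) ^ (2 / α + η)) * (1 + 3)) := by
        refine mul_le_mul ?_ hsum (abs_nonneg _) (by positivity)
        apply Real.rpow_le_rpow_of_exponent_le (by norm_num)
        have : (0 : ℝ) ≤ j := by positivity
        nlinarith [hv.1]
    _ = _ := by
        have : (2 : ℝ) ^ (-(j : ℝ) * (a - 1 / α)) =
            (2 : ℝ) ^ (-(j : ℝ) * a) * (2 : ℝ) ^ ((j : ℝ) / α) := by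
          rw [← Real.rpow_add (by norm_num)]
          congr 1
          ring
        rw [this]
        ring

lemma summable_two_rpow_neg_mul_rpow {δ : ℝ} (hδ : 0 < δ) (q : ℝ) :
    Summable fun j : ℕ => (2 : ℝ) ^ (-(j : ℝ) * δ) * (1 + j : ℝ) ^ q := by
  obtain ⟨n, hn⟩ := exists_nat_ge q
  have hr : ‖(2 : ℝ) ^ (-δ)‖ < 1 := by
    rw [Real.norm_of_nonneg (by positivity)]
    exact Real.rpow_lt_one_of_one_lt_of_neg (by norm_num) (by linarith)
  have h : Summable fun j : ℕ => ((j + 1 : ℕ) : ℝ) ^ n * ((2 : ℝ) ^ (-δ)) ^ (j + 1) :=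
    (summable_pow_mul_geometric_of_norm_lt_one n hr).comp_injective (add_left_injective 1)
  refine Summable.of_nonneg_of_le (fun j => by positivity) (fun j => ?_)
    (h.mul_left ((2 : ℝ) ^ δ))
  have e : (2 : ℝ) ^ (-(j : ℝ) * δ) = (2 : ℝ) ^ δ * ((2 : ℝ) ^ (-δ)) ^ (j + 1) := by
    rw [← Real.rpow_natCast, ← Real.rpow_mul (by norm_num), ← Real.rpow_add (by norm_num)]
    congr 1
    push_cast
    ring
  rw [e]
  calc _ ≤ (2 : ℝ) ^ δ * ((2 : ℝ) ^ (-δ)) ^ (j + 1) * (1 + j : ℝ) ^ (n : ℝ) := by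
        gcongr
        have : (0 : ℝ) ≤ j := by positivity
        linarith
    _ = _ := by
        rw [Real.rpow_natCast]
        push_cast
        ring

/-- The tail factors because `1 + J + i ≤ (1+J)(1+i)`. -/
lemma tsum_two_rpow_neg_mul_rpow_le {δ : ℝ} (hδ : 0 < δ) {q : ℝ} (hq : 0 ≤ q) (J : ℕ) :
    ∑' i : ℕ, (2 : ℝ) ^ (-((J + i : ℕ) : ℝ) * δ) * (1 + (J + i : ℕ) : ℝ) ^ q ≤
      ((2 : ℝ) ^ (-(J : ℝ) * δ) * (1 + J : ℝ) ^ q) *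
        ∑' i : ℕ, (2 : ℝ) ^ (-(i : ℝ) * δ) * (1 + i : ℝ) ^ q := by
  have hs := summable_two_rpow_neg_mul_rpow hδ q
  rw [← tsum_mul_left]
  refine Summable.tsum_le_tsum (fun i => ?_) ?_ (hs.mul_left _)
  · have e : (2 : ℝ) ^ (-((J + i : ℕ) : ℝ) * δ) =
        (2 : ℝ) ^ (-(J : ℝ) * δ) * (2 : ℝ) ^ (-(i : ℝ) * δ) := by
      rw [← Real.rpow_add (by norm_num)]
      congr 1
      push_cast
      ring
    have h : (1 + (J + i : ℕ) : ℝ) ^ q ≤ (1 + J : ℝ) ^ q * (1 + i : ℝ) ^ q := by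
      rw [← Real.mul_rpow (by positivity) (by positivity)]
      refine Real.rpow_le_rpow (by positivity) ?_ hq
      push_cast
      have : (0 : ℝ) ≤ J * i := by positivity
      nlinarith
    rw [e]
    calc _ ≤ (2 : ℝ) ^ (-(J : ℝ) * δ) * (2 : ℝ) ^ (-(i : ℝ) * δ) *
          ((1 + J : ℝ) ^ q * (1 + i : ℝ) ^ q) := by gcongr
      _ = _ := by ring
  · exact hs.comp_injective (add_right_injective J)

/-- The Haar partial sum as a continuous function on the rectangle `[0,1] × [a,b]`. -/
noncomputable def partialSumMap {Ω : Type*} {α a : ℝ} (ha : 1 / α < a) (b : ℝ) (Z : ℝ → Ω → ℝ)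
    (J : ℕ) (ω : Ω) : C(Rect a b, ℝ) where
  toFun p := partialSum α Z J p.1 p.2 ω
  continuous_toFun := by
    have h0 : ∀ p : Rect a b, 1 / α < (p.2 : ℝ) := fun p => ha.trans_le p.2.2.1
    have hθ : ∀ j k : ℕ, Continuous fun p : Rect a b => theta α (2 ^ j * (p.1 : ℝ) - k) p.2 := by
      intro j k
      exact continuousOn_theta.comp_continuous
        (f := fun p : Rect a b => ((2 : ℝ) ^ j * (p.1 : ℝ) - k, (p.2 : ℝ))) (by fun_prop) h0
    unfold partialSum
    refine Continuous.add (Continuous.mul (Continuous.div ?_ (by fun_prop) ?_) continuous_const) ?_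
    · refine Continuous.rpow (by fun_prop) (by fun_prop) fun p => Or.inr ?_
      linarith [h0 p]
    · intro p
      linarith [h0 p]
    · refine continuous_finsetSum _ fun j _ => Continuous.mul ?_
        (continuous_finsetSum _ fun k _ => continuous_const.mul (hθ j k))
      exact Continuous.rpow continuous_const (by fun_prop) fun p => Or.inl (by norm_num)

lemma dist_partialSumMap_le {Ω : Type*} {α a b : ℝ} (hα : 1 < α) (ha : 1 / α < a) (hb : b < 1)
    {Z : ℝ → Ω → ℝ} {ω : Ω} (hω : ω ∈ goodEvent α Z) {η : ℝ} (hη : 0 < η) :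
    ∃ C : ℝ, 0 < C ∧ ∀ j : ℕ,
      dist (partialSumMap ha b Z j ω) (partialSumMap ha b Z j.succ ω) ≤
        C * ((2 : ℝ) ^ (-(j : ℝ) * (a - 1 / α)) * (1 + j : ℝ) ^ (2 / α + η)) := by
  obtain ⟨C, hC, h⟩ := exists_abs_partialSum_sub_le hα hω ha hb hη
  refine ⟨C, hC, fun j => (ContinuousMap.dist_le (by positivity)).2 fun p => ?_⟩
  rw [dist_comm]
  exact h j p.1 p.2 p.2.2

lemma exists_tendsto_partialSumMap {Ω : Type*} {α a b : ℝ} (hα : 1 < α) (ha : 1 / α < a)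
    (hb : b < 1) {Z : ℝ → Ω → ℝ} {ω : Ω} (hω : ω ∈ goodEvent α Z) :
    ∃ X : C(Rect a b, ℝ), Tendsto (fun J => partialSumMap ha b Z J ω) atTop (𝓝 X) := by
  obtain ⟨C, hC, h⟩ := dist_partialSumMap_le hα ha hb hω one_pos
  exact cauchySeq_tendsto_of_complete (cauchySeq_of_dist_le_of_summable _ h
    ((summable_two_rpow_neg_mul_rpow (sub_pos.2 ha) _).mul_left C))

lemma isBigO_sub_partialSumMap {Ω : Type*} {α a b : ℝ} (hα : 1 < α) (ha : 1 / α < a)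
    (hb : b < 1) {Z : ℝ → Ω → ℝ} {ω : Ω} (hω : ω ∈ goodEvent α Z) {X : C(Rect a b, ℝ)}
    (hX : Tendsto (fun J => partialSumMap ha b Z J ω) atTop (𝓝 X)) {η : ℝ} (hη : 0 < η) :
    (fun J : ℕ => ‖X - partialSumMap ha b Z J ω‖) =O[atTop]
      (fun J : ℕ => (2 : ℝ) ^ (-(J : ℝ) * (a - 1 / α)) * (J : ℝ) ^ (2 / α + η)) := by
  obtain ⟨C, hC, h⟩ := dist_partialSumMap_le hα ha hb hω hη
  have hδ : 0 < a - 1 / α := sub_pos.2 ha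
  have hq : 0 < 2 / α + η := by positivity
  set S := ∑' i : ℕ, (2 : ℝ) ^ (-(i : ℝ) * (a - 1 / α)) * (1 + i : ℝ) ^ (2 / α + η)
  have hS : 0 ≤ S := tsum_nonneg fun i => by positivity
  refine Asymptotics.IsBigO.of_bound (C * S * 2 ^ (2 / α + η)) ?_
  filter_upwards [eventually_ge_atTop 1] with J hJ
  have h1 := dist_le_tsum_of_dist_le_of_tendsto _ h
    ((summable_two_rpow_neg_mul_rpow hδ _).mul_left C) hX J
  rw [tsum_mul_left] at h1
  have h2 := tsum_two_rpow_neg_mul_rpow_le hδ hq.le J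
  have hJ' : (1 : ℝ) ≤ J := by exact_mod_cast hJ
  have h3 : (1 + J : ℝ) ^ (2 / α + η) ≤ 2 ^ (2 / α + η) * (J : ℝ) ^ (2 / α + η) := by
    rw [← Real.mul_rpow (by norm_num) (by positivity)]
    refine Real.rpow_le_rpow (by positivity) (by linarith) hq.le
  rw [norm_norm, ← dist_eq_norm, dist_comm, Real.norm_of_nonneg (by positivity)]
  calc _ ≤ C * (((2 : ℝ) ^ (-(J : ℝ) * (a - 1 / α)) * (1 + J : ℝ) ^ (2 / α + η)) * S) :=
        h1.trans (by gcongr)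
    _ ≤ C * (((2 : ℝ) ^ (-(J : ℝ) * (a - 1 / α)) *
        (2 ^ (2 / α + η) * (J : ℝ) ^ (2 / α + η))) * S) := by gcongr
    _ = _ := by ring

/-! ### Stable laws -/

/-- The characteristic function of `μ` is `t ↦ exp (-s |t|^α)`. -/
def HasStableExponent (α s : ℝ) (μ : Measure ℝ) : Prop :=
  ∀ t : ℝ, charFun μ t = Complex.exp (-((s * |t| ^ α : ℝ) : ℂ))

/-- The tail of a stable law. -/
lemma HasStableExponent.measureReal_abs_gt_le {α s : ℝ} (hα : 0 < α) (hα₂ : α ≤ 2) (hs : 0 ≤ s)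
    {μ : Measure ℝ} [IsProbabilityMeasure μ] (h : HasStableExponent α s μ) {r : ℝ} (hr : 0 < r) :
    μ.real {x | r < |x|} ≤ 8 * s / r ^ α := by
  refine (measureReal_abs_gt_le_integral_charFun hr).trans ?_
  have hb : ∀ t ∈ Set.uIoc (-2 * r⁻¹) (2 * r⁻¹), ‖1 - charFun μ t‖ ≤ s * (2 * r⁻¹) ^ α := by
    intro t ht
    have hr' : 0 < r⁻¹ := inv_pos.2 hr
    rw [Set.uIoc_of_le (by linarith)] at ht
    have ht' : |t| ≤ 2 * r⁻¹ := abs_le.2 ⟨by linarith [ht.1], ht.2⟩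
    have h1 : s * |t| ^ α ≤ s * (2 * r⁻¹) ^ α := by gcongr
    have h0 : 0 ≤ s * |t| ^ α := by positivity
    rw [h t]
    refine le_trans ?_ h1
    rw [← Complex.ofReal_neg, ← Complex.ofReal_exp, ← Complex.ofReal_one, ← Complex.ofReal_sub,
      Complex.norm_real, Real.norm_of_nonneg]
    · linarith [Real.add_one_le_exp (-(s * |t| ^ α))]
    · exact sub_nonneg.2 (Real.exp_le_one_iff.2 (by linarith))
  have h2 := intervalIntegral.norm_integral_le_of_norm_le_const hb
  have e : |2 * r⁻¹ - -2 * r⁻¹| = 4 * r⁻¹ := by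
    rw [abs_of_nonneg] <;> ring_nf
    positivity
  rw [e] at h2
  calc _ ≤ 2⁻¹ * r * (s * (2 * r⁻¹) ^ α * (4 * r⁻¹)) := by gcongr
    _ = 2 * 2 ^ α * s / r ^ α := by
        rw [Real.mul_rpow (by norm_num) (by positivity), Real.inv_rpow hr.le]
        field_simp
        ring
    -- The constant is `2 · 2^α`, and `α ≤ 2`.
    _ ≤ 8 * s / r ^ α := by
        have : (2 : ℝ) ^ α ≤ 2 ^ (2 : ℝ) := by gcongr; norm_num
        norm_num at this
        gcongr
        linarith

lemma HasStableExponent.prob_abs_gt_le {Ω : Type*} [MeasurableSpace Ω] {P : Measure Ω}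
    [IsProbabilityMeasure P] {α s : ℝ} (hα : 0 < α) (hα₂ : α ≤ 2) (hs : 0 ≤ s)
    {X : Ω → ℝ} (hX : AEMeasurable X P) (h : HasStableExponent α s (P.map X))
    {r : ℝ} (hr : 0 < r) : P.real {ω | r < |X ω|} ≤ 8 * s / r ^ α := by
  have := Measure.isProbabilityMeasure_map hX
  have h1 := h.measureReal_abs_gt_le hα hα₂ hs hr
  have hms : MeasurableSet {x : ℝ | r < |x|} :=
    measurableSet_lt measurable_const measurable_id.abs
  rw [measureReal_def, Measure.map_apply_of_aemeasurable hX hms] at h1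
  exact h1

/-- Written with `s = σ^α`, exponents add over independent summands. The coefficients enter only
through `|c i|`, so signs do not matter. -/
lemma HasStableExponent.sum {Ω ι : Type*} [MeasurableSpace Ω] {P : Measure Ω}
    [IsProbabilityMeasure P] {α : ℝ} {S : Finset ι} {X : ι → Ω → ℝ} {s c : ι → ℝ}
    (hX : ∀ i ∈ S, Measurable (X i)) (hind : iIndepFun (S.restrict X) P)
    (h : ∀ i ∈ S, HasStableExponent α (s i) (P.map (X i))) :
    HasStableExponent α (∑ i ∈ S, |c i| ^ α * s i) (P.map fun ω => ∑ i ∈ S, c i * X i ω) := by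
  intro t
  have hind' : iIndepFun (S.restrict fun i ω => c i * X i ω) P :=
    hind.comp (fun i x => c i * x) fun i => measurable_const_mul _
  rw [iIndepFun.charFun_map_fun_finsetSum_eq_prod
    (fun i hi => ((hX i hi).const_mul (c i)).aemeasurable) hind', Finset.prod_apply,
    Finset.sum_mul, Complex.ofReal_sum, ← Finset.sum_neg_distrib, Complex.exp_sum]
  refine Finset.prod_congr rfl fun i hi => ?_
  rw [charFun_map_mul_comp (hX i hi).aemeasurable, h i hi, abs_mul,
    Real.mul_rpow (abs_nonneg _) (abs_nonneg _)]
  congr 3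
  ring

/-! ### Stable random measures -/

section RandomMeasure

variable {Ω : Type*} [MeasurableSpace Ω] {P : Measure Ω} {α : ℝ}
  {M : Set ℝ → Ω → ℝ}

lemma finBorel_empty : FinBorel ∅ := ⟨MeasurableSet.empty, by simp⟩

lemma FinBorel.union {A B : Set ℝ} (hA : FinBorel A) (hB : FinBorel B) : FinBorel (A ∪ B) :=
  ⟨hA.1.union hB.1, measure_union_lt_top hA.2 hB.2⟩

lemma finBorel_Ioc (a b : ℝ) : FinBorel (Set.Ioc a b) := ⟨measurableSet_Ioc, measure_Ioc_lt_top⟩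

lemma FinBorel.biUnion {ι : Type*} {S : Finset ι} {A : ι → Set ℝ} (hA : ∀ i ∈ S, FinBorel (A i)) :
    FinBorel (⋃ i ∈ S, A i) :=
  ⟨S.measurableSet_biUnion fun i hi => (hA i hi).1,
    measure_biUnion_lt_top S.finite_toSet fun i hi => (hA i hi).2⟩

lemma IsSaSRandomMeasure.hasStableExponent (hα : 0 < α) (hM : IsSaSRandomMeasure P α M)
    {A : Set ℝ} (hA : FinBorel A) : HasStableExponent α (volume.real A) (P.map (M A)) := by
  intro t
  rw [hM.law A hA t, ← Real.rpow_mul measureReal_nonneg, one_div_mul_cancel hα.ne', Real.rpow_one]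

lemma IsSaSRandomMeasure.iIndepFun_restrict {ι : Type*} (hM : IsSaSRandomMeasure P α M)
    {S : Finset ι} {A : ι → Set ℝ} (hA : ∀ i ∈ S, FinBorel (A i))
    (hd : (S : Set ι).PairwiseDisjoint A) : iIndepFun (S.restrict fun i => M (A i)) P := by
  have h := hM.indep S.card (fun i => A (S.equivFin.symm i)) (fun i => hA _ (S.equivFin.symm i).2)
    (fun i j hij => hd (S.equivFin.symm i).2 (S.equivFin.symm j).2 fun h =>
      hij (S.equivFin.symm.injective (Subtype.ext h)))
  have h2 := h.precomp S.equivFin.injective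
  simp only [Equiv.symm_apply_apply] at h2
  exact h2

variable [IsProbabilityMeasure P]

lemma IsSaSRandomMeasure.hasStableExponent_sum {ι : Type*} (hα : 0 < α)
    (hM : IsSaSRandomMeasure P α M) {S : Finset ι} {A : ι → Set ℝ} (c : ι → ℝ)
    (hA : ∀ i ∈ S, FinBorel (A i)) (hd : (S : Set ι).PairwiseDisjoint A) :
    HasStableExponent α (∑ i ∈ S, |c i| ^ α * volume.real (A i))
      (P.map fun ω => ∑ i ∈ S, c i * M (A i) ω) :=
  HasStableExponent.sum (fun i hi => hM.measurable _ (hA i hi)) (hM.iIndepFun_restrict hA hd)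
    fun i hi => hM.hasStableExponent hα (hA i hi)

/-- Exponent 0 makes the characteristic function constantly 1, which forces the Dirac mass at 0. -/
lemma IsSaSRandomMeasure.ae_empty (hα : 0 < α) (hM : IsSaSRandomMeasure P α M) :
    ∀ᵐ ω ∂P, M ∅ ω = 0 := by
  have hm := hM.measurable ∅ finBorel_empty
  have := Measure.isProbabilityMeasure_map (μ := P) hm.aemeasurable
  have h : P.map (M ∅) = Measure.dirac 0 := by
    refine Measure.ext_of_charFun ?_
    funext t
    rw [hM.hasStableExponent hα finBorel_empty t, charFun_dirac]
    simp
  have h1 : ∀ᵐ x ∂(P.map (M ∅)), x = 0 := by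
    rw [h]
    simp [ae_dirac_eq]
  exact ae_of_ae_map hm.aemeasurable h1

/-- Finite additivity is σ-additivity for the sequence padded with empty sets, whose mass vanishes
almost surely. -/
lemma IsSaSRandomMeasure.ae_union (hα : 0 < α) (hM : IsSaSRandomMeasure P α M) {A B : Set ℝ}
    (hA : FinBorel A) (hB : FinBorel B) (hd : Disjoint A B) :
    ∀ᵐ ω ∂P, M (A ∪ B) ω = M A ω + M B ω := by
  let D : ℕ → Set ℝ := fun n => if n = 0 then A else if n = 1 then B else ∅
  have hD : ∀ i, FinBorel (D i) := by
    intro i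
    simp only [D]
    split_ifs
    exacts [hA, hB, finBorel_empty]
  have hU : ⋃ i, D i = A ∪ B := by
    ext x
    simp only [Set.mem_iUnion, Set.mem_union, D]
    constructor
    · rintro ⟨i, hi⟩
      split_ifs at hi
      exacts [Or.inl hi, Or.inr hi, hi.elim]
    · rintro (h | h)
      exacts [⟨0, by simpa using h⟩, ⟨1, by simpa using h⟩]
  have hdis : Pairwise fun i j => Disjoint (D i) (D j) := by
    intro i j hij
    simp only [D]
    split_ifs <;> simp_all [hd.symm]
  filter_upwards [hM.sigma_additive D hD (by rw [hU]; exact (hA.union hB).2) hdis,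
    hM.ae_empty hα] with ω hω h0
  rw [hU] at hω
  refine tendsto_nhds_unique hω (tendsto_const_nhds.congr' ?_)
  filter_upwards [eventually_ge_atTop 2] with n hn
  rw [← Finset.sum_subset (Finset.range_subset_range.2 hn)]
  · simp [Finset.sum_range_succ, D]
  · intro i _ hi
    have h1 : i ≠ 0 := by rintro rfl; simp at hi
    have h2 : i ≠ 1 := by rintro rfl; simp at hi
    simp [D, h1, h2, h0]

lemma IsSaSRandomMeasure.ae_biUnion {ι : Type*} (hα : 0 < α) (hM : IsSaSRandomMeasure P α M)
    {S : Finset ι} {A : ι → Set ℝ} (hA : ∀ i ∈ S, FinBorel (A i))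
    (hd : (S : Set ι).PairwiseDisjoint A) :
    ∀ᵐ ω ∂P, M (⋃ i ∈ S, A i) ω = ∑ i ∈ S, M (A i) ω := by
  classical
  induction S using Finset.induction_on with
  | empty => simpa using hM.ae_empty hα
  | insert i S hi ih =>
    have hA' : ∀ k ∈ S, FinBorel (A k) := fun k hk => hA k (Finset.mem_insert_of_mem hk)
    have h1 := ih hA' (hd.subset (by simp))
    have hdis : Disjoint (A i) (⋃ k ∈ S, A k) := by
      rw [Set.disjoint_iUnion₂_right]
      intro k hk
      exact hd (by simp) (by simp [hk]) (by rintro rfl; exact hi hk)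
    filter_upwards [h1, hM.ae_union hα (hA i (by simp)) (FinBorel.biUnion hA') hdis]
      with ω h2 h3
    rw [Finset.set_biUnion_insert, h3, h2, Finset.sum_insert hi]

/-! ### Integrals of simple functions -/

/-- The integral of a simple function of the form `φ ∘ q` as a sum over the level sets of `q`. -/
lemma IsSaSRandomMeasure.ae_simpleIntegral_map {β : Type*} [Zero β] [DecidableEq β] (hα : 0 < α)
    (hM : IsSaSRandomMeasure P α M) (q : SimpleFunc ℝ β)
    (hq : ∀ y, y ≠ 0 → volume (q ⁻¹' {y}) < ⊤) (φ : β → ℝ) (hφ : φ 0 = 0) :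
    ∀ᵐ ω ∂P, simpleIntegral M (q.map φ) ω =
      ∑ y ∈ q.range with y ≠ 0, φ y * M (q ⁻¹' {y}) ω := by
  classical
  have key : ∀ c ∈ (q.map φ).range, ∀ᵐ ω ∂P, c * M ((q.map φ) ⁻¹' {c}) ω =
      ∑ y ∈ q.range with φ y = c, φ y * M (q ⁻¹' {y}) ω := by
    intro c _
    -- The zero level set may have infinite volume, where nothing is known about `M`; the factor `c`
    -- removes it.
    by_cases hc : c = 0
    · refine ae_of_all _ fun ω => ?_
      rw [hc, zero_mul, Finset.sum_eq_zero]
      intro y hy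
      rw [(Finset.mem_filter.1 hy).2, zero_mul]
    · have hy0 : ∀ y ∈ q.range.filter (fun y => φ y = c), FinBorel (q ⁻¹' {y}) := by
        intro y hy
        refine ⟨q.measurableSet_fiber y, hq y ?_⟩
        rintro rfl
        exact hc ((Finset.mem_filter.1 hy).2.symm.trans hφ)
      have hd : ((q.range.filter (fun y => φ y = c) : Finset β) : Set β).PairwiseDisjoint
          fun y => q ⁻¹' {y} := fun y _ z _ hyz =>
        Disjoint.preimage _ (Set.disjoint_singleton.2 hyz)
      have e : (q.map φ) ⁻¹' {c} = ⋃ y ∈ q.range.filter (fun y => φ y = c), q ⁻¹' {y} := by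
        rw [SimpleFunc.map_preimage_singleton]
        ext x
        simp
      filter_upwards [hM.ae_biUnion hα hy0 hd] with ω hω
      rw [e, hω, Finset.mul_sum]
      refine Finset.sum_congr rfl fun y hy => ?_
      rw [(Finset.mem_filter.1 hy).2]
  filter_upwards [(Finset.eventually_all _).2 key] with ω hω
  rw [simpleIntegral, Finset.sum_congr rfl hω, Finset.sum_fiberwise_of_maps_to]
  · refine (Finset.sum_filter_of_ne fun y _ hy => ?_).symm
    rintro rfl
    exact hy (by rw [hφ, zero_mul])
  · intro y hy
    rw [SimpleFunc.range_map]
    exact Finset.mem_image_of_mem φ hy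

/-- The right side is the stable exponent of the integral of `φ ∘ q`, so closeness in `L^α` controls
the law. -/
lemma toReal_eLpNorm_simpleFunc_rpow {β : Type*} [Zero β] [DecidableEq β] (hα : 0 < α)
    (q : SimpleFunc ℝ β) (hq : ∀ y, y ≠ 0 → volume (q ⁻¹' {y}) < ⊤) (φ : β → ℝ) (hφ : φ 0 = 0) :
    (eLpNorm (fun x => φ (q x)) (ENNReal.ofReal α) volume).toReal ^ α =
      ∑ y ∈ q.range with y ≠ 0, |φ y| ^ α * volume.real (q ⁻¹' {y}) := by
  have hl : ∫⁻ x, ‖φ (q x)‖ₑ ^ α = ∑ y ∈ q.range, ‖φ y‖ₑ ^ α * volume (q ⁻¹' {y}) := by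
    rw [← SimpleFunc.map_lintegral (fun y => ‖φ y‖ₑ ^ α), ← SimpleFunc.lintegral_eq_lintegral]
    rfl
  rw [eLpNorm_eq_lintegral_rpow_enorm_toReal (by simpa using hα) ENNReal.ofReal_ne_top,
    ENNReal.toReal_ofReal hα.le, ENNReal.toReal_rpow, ← ENNReal.rpow_mul,
    one_div_mul_cancel hα.ne', ENNReal.rpow_one, hl]
  have e : ∑ y ∈ q.range, ‖φ y‖ₑ ^ α * volume (q ⁻¹' {y}) =
      ∑ y ∈ q.range with y ≠ 0, ‖φ y‖ₑ ^ α * volume (q ⁻¹' {y}) := by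
    refine (Finset.sum_filter_of_ne fun y _ hy => ?_).symm
    rintro rfl
    exact hy (by simp [hφ, hα])
  rw [e, ENNReal.toReal_sum]
  · refine Finset.sum_congr rfl fun y _ => ?_
    rw [ENNReal.toReal_mul, ← ENNReal.toReal_rpow, toReal_enorm, Real.norm_eq_abs, measureReal_def]
  · intro y hy
    exact ENNReal.mul_ne_top (ENNReal.rpow_ne_top_of_nonneg hα.le enorm_ne_top)
      (hq y (Finset.mem_filter.1 hy).2).ne

/-- The integrals of two simple functions are close in probability if the functions are close
in `L^α`. -/
lemma IsSaSRandomMeasure.prob_abs_simpleIntegral_sub_gt_le (hα : 0 < α) (hα₂ : α ≤ 2)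
    (hM : IsSaSRandomMeasure P α M) {g h : SimpleFunc ℝ ℝ}
    (hg : MemLp g (ENNReal.ofReal α) volume) (hh : MemLp h (ENNReal.ofReal α) volume)
    {r : ℝ} (hr : 0 < r) :
    P.real {ω | r < |simpleIntegral M g ω - simpleIntegral M h ω|} ≤
      8 * (eLpNorm (fun s => g s - h s) (ENNReal.ofReal α) volume).toReal ^ α / r ^ α := by
  classical
  have hα' : ENNReal.ofReal α ≠ 0 := by simpa using hα
  -- The level sets of the pair refine those of `g` and `h`; over them the difference of integrals
  -- is a sum of independent stable variables.
  set q : SimpleFunc ℝ (ℝ × ℝ) := g.pair h with hqdef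
  have hq : ∀ y, y ≠ 0 → volume (q ⁻¹' {y}) < ⊤ := by
    rintro ⟨y, z⟩ hyz
    rw [hqdef, SimpleFunc.pair_preimage_singleton]
    by_cases hy : y = 0
    · have hz : z ≠ 0 := by
        rintro rfl
        exact hyz (by rw [hy]; rfl)
      exact (measure_mono Set.inter_subset_right).trans_lt
        (SimpleFunc.measure_preimage_lt_top_of_memLp hα' ENNReal.ofReal_ne_top h hh z hz)
    · exact (measure_mono Set.inter_subset_left).trans_lt
        (SimpleFunc.measure_preimage_lt_top_of_memLp hα' ENNReal.ofReal_ne_top g hg y hy)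
  have e1 := hM.ae_simpleIntegral_map hα q hq Prod.fst rfl
  have e2 := hM.ae_simpleIntegral_map hα q hq Prod.snd rfl
  have hfst : q.map Prod.fst = g := by ext x; rfl
  have hsnd : q.map Prod.snd = h := by ext x; rfl
  rw [hfst] at e1
  rw [hsnd] at e2
  have hfin : ∀ y ∈ q.range.filter (fun y => y ≠ 0), FinBorel (q ⁻¹' {y}) := fun y hy =>
    ⟨q.measurableSet_fiber y, hq y (Finset.mem_filter.1 hy).2⟩
  have hd : ((q.range.filter (fun y => y ≠ 0) : Finset (ℝ × ℝ)) : Set (ℝ × ℝ)).PairwiseDisjoint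
      fun y => q ⁻¹' {y} := fun y _ z _ hyz =>
    Disjoint.preimage _ (Set.disjoint_singleton.2 hyz)
  have hlaw := hM.hasStableExponent_sum hα (fun y : ℝ × ℝ => y.1 - y.2) hfin hd
  have hnorm := toReal_eLpNorm_simpleFunc_rpow hα q hq (fun y : ℝ × ℝ => y.1 - y.2) (by simp)
  rw [← hnorm] at hlaw
  have hmeas : AEMeasurable (fun ω => ∑ y ∈ q.range with y ≠ 0,
      (y.1 - y.2) * M (q ⁻¹' {y}) ω) P :=
    (Finset.measurable_fun_sum _ fun y hy =>
      (hM.measurable _ (hfin y hy)).const_mul _).aemeasurable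
  have htail := hlaw.prob_abs_gt_le hα hα₂ (by positivity) hmeas hr
  refine le_trans (le_of_eq ?_) htail
  refine measureReal_congr ?_
  filter_upwards [e1, e2] with ω h1 h2
  have : simpleIntegral M g ω - simpleIntegral M h ω =
      ∑ y ∈ q.range with y ≠ 0, (y.1 - y.2) * M (q ⁻¹' {y}) ω := by
    rw [h1, h2, ← Finset.sum_sub_distrib]
    exact Finset.sum_congr rfl fun y _ => by ring
  change (r < |simpleIntegral M g ω - simpleIntegral M h ω|) = _
  rw [this]
  rfl

end RandomMeasure

/-! ### A maximal inequality for sums of independent variables -/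

section Maximal

variable {Ω : Type*} [MeasurableSpace Ω] {P : Measure Ω}

/-- First passage at time `k` depends only on the variables before `k`, the remainder only on those
from `k` on; `T` expresses the partial sums as functions of the first block. -/
lemma indep_first_passage {W : ℕ → Ω → ℝ} (hW : ∀ i, Measurable (W i)) (hind : iIndepFun W P)
    (x y : ℝ) (k n : ℕ) :
    P.real ({ω | (∀ i < k, |∑ m ∈ Finset.range i, W m ω| ≤ y) ∧
        y < |∑ m ∈ Finset.range k, W m ω|} ∩ {ω | |∑ m ∈ Finset.Ico k n, W m ω| ≤ x}) =
      P.real {ω | (∀ i < k, |∑ m ∈ Finset.range i, W m ω| ≤ y) ∧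
        y < |∑ m ∈ Finset.range k, W m ω|} *
      P.real {ω | |∑ m ∈ Finset.Ico k n, W m ω| ≤ x} := by
  have hdis : Disjoint (Finset.range k) (Finset.Ico k n) := by
    rw [Finset.range_eq_Ico]
    exact Finset.Ico_disjoint_Ico_consecutive 0 k n
  have h := hind.indepFun_finset _ _ hdis hW
  let T : ℕ → (Finset.range k → ℝ) → ℝ := fun i z =>
    ∑ m : Finset.range k, if (m : ℕ) < i then z m else 0
  have hT : ∀ i, Measurable (T i) := fun i => by
    refine Finset.measurable_fun_sum _ fun m _ => ?_
    by_cases hm : (m : ℕ) < i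
    · simpa [hm] using measurable_pi_apply m
    · simp [hm]
  have hTW : ∀ i ≤ k, ∀ ω, T i (fun m => W m ω) = ∑ m ∈ Finset.range i, W m ω := by
    intro i hi ω
    simp only [T]
    rw [Finset.sum_coe_sort (Finset.range k) (fun m => if m < i then W m ω else 0),
      ← Finset.sum_filter]
    congr 1
    ext m
    simp only [Finset.mem_filter, Finset.mem_range]
    omega
  let A : Set (Finset.range k → ℝ) := {z | (∀ i < k, |T i z| ≤ y) ∧ y < |T k z|}
  let B : Set (Finset.Ico k n → ℝ) := {z | |∑ m, z m| ≤ x}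
  have hA : MeasurableSet A := by
    have e : A = (⋂ i, ⋂ (_ : i < k), {z | |T i z| ≤ y}) ∩ {z | y < |T k z|} := by
      ext z
      simp [A]
    rw [e]
    refine MeasurableSet.inter (MeasurableSet.iInter fun i => MeasurableSet.iInter fun _ => ?_) ?_
    · exact measurableSet_le (hT i).abs measurable_const
    · exact measurableSet_lt measurable_const (hT k).abs
  have hB : MeasurableSet B :=
    measurableSet_le (Finset.measurable_fun_sum _ fun m _ => measurable_pi_apply m).abs
      measurable_const
  have h2 := h.measure_inter_preimage_eq_mul A B hA hB
  have eA : (fun ω (i : Finset.range k) => W i ω) ⁻¹' A =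
      {ω | (∀ i < k, |∑ m ∈ Finset.range i, W m ω| ≤ y) ∧
        y < |∑ m ∈ Finset.range k, W m ω|} := by
    ext ω
    simp only [A, Set.mem_preimage, Set.mem_ofPred_eq, hTW k le_rfl]
    refine and_congr_left fun _ => forall₂_congr fun i hi => ?_
    rw [hTW i hi.le]
  have eB : (fun ω (i : Finset.Ico k n) => W i ω) ⁻¹' B =
      {ω | |∑ m ∈ Finset.Ico k n, W m ω| ≤ x} := by
    ext ω
    simp only [B, Set.mem_preimage, Set.mem_ofPred_eq]
    rw [Finset.sum_coe_sort (Finset.Ico k n) (fun m => W m ω)]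
  rw [eA, eB] at h2
  simp only [measureReal_def, h2, ENNReal.toReal_mul]

variable [IsProbabilityMeasure P]

/-- Ottaviani's inequality. -/
lemma prob_exists_abs_sum_gt_le {W : ℕ → Ω → ℝ} (hW : ∀ i, Measurable (W i))
    (hind : iIndepFun W P) {x : ℝ} {n : ℕ}
    (hx : ∀ k ≤ n, P.real {ω | x < |∑ m ∈ Finset.Ico k n, W m ω|} ≤ 1 / 2) :
    P.real {ω | ∃ k ≤ n, 2 * x < |∑ m ∈ Finset.range k, W m ω|} ≤
      2 * P.real {ω | x < |∑ m ∈ Finset.range n, W m ω|} := by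
  have hS : ∀ s : Finset ℕ, Measurable fun ω => ∑ m ∈ s, W m ω := fun s =>
    Finset.measurable_fun_sum _ fun m _ => hW m
  -- The disjoint events `A k` mark the first passage above `2x` at `k`. On `A k ∩ B k` the full sum
  -- still exceeds `x`, and independence with `P (B k) ≥ 1/2` loses only a factor 2.
  set A : ℕ → Set Ω := fun k => {ω | (∀ i < k, |∑ m ∈ Finset.range i, W m ω| ≤ 2 * x) ∧
        2 * x < |∑ m ∈ Finset.range k, W m ω|} with hAdef
  set B : ℕ → Set Ω := fun k => {ω | |∑ m ∈ Finset.Ico k n, W m ω| ≤ x} with hBdef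
  have hA : ∀ k, MeasurableSet (A k) := by
    intro k
    have e : A k = (⋂ i, ⋂ (_ : i < k), {ω | |∑ m ∈ Finset.range i, W m ω| ≤ 2 * x}) ∩
        {ω | 2 * x < |∑ m ∈ Finset.range k, W m ω|} := by
      ext ω
      simp [A]
    rw [e]
    refine MeasurableSet.inter (MeasurableSet.iInter fun i => MeasurableSet.iInter fun _ => ?_) ?_
    · exact measurableSet_le (hS _).abs measurable_const
    · exact measurableSet_lt measurable_const (hS _).abs
  have hB : ∀ k, MeasurableSet (B k) := fun k => measurableSet_le (hS _).abs measurable_const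
  have hBprob : ∀ k ≤ n, 1 / 2 ≤ P.real (B k) := by
    intro k hk
    have e : (B k)ᶜ = {ω | x < |∑ m ∈ Finset.Ico k n, W m ω|} := by
      ext ω
      simp [B]
    have h1 := probReal_compl_eq_one_sub (μ := P) (hB k)
    rw [e] at h1
    linarith [hx k hk]
  have hsub : {ω | ∃ k ≤ n, 2 * x < |∑ m ∈ Finset.range k, W m ω|} ⊆
      ⋃ k ∈ Finset.range (n + 1), A k := by
    classical
    rintro ω ⟨k, hk, hkx⟩
    have hex : ∃ k, 2 * x < |∑ m ∈ Finset.range k, W m ω| := ⟨k, hkx⟩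
    simp only [Set.mem_iUnion, Finset.mem_range]
    refine ⟨Nat.find hex, Nat.lt_succ_of_le ((Nat.find_min' hex hkx).trans hk), fun i hi => ?_,
      Nat.find_spec hex⟩
    exact not_lt.1 (Nat.find_min hex hi)
  have hdisj : ∀ i k, i < k → Disjoint (A i) (A k) := by
    intro i k hik
    rw [Set.disjoint_left]
    rintro ω ⟨_, h1⟩ ⟨h2, _⟩
    exact absurd h1 (not_lt.2 (h2 i hik))
  have hdis : ((Finset.range (n + 1) : Finset ℕ) : Set ℕ).PairwiseDisjoint
      fun k => A k ∩ B k := by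
    intro i _ k _ hik
    refine Disjoint.mono Set.inter_subset_left Set.inter_subset_left ?_
    rcases lt_or_gt_of_ne hik with h | h
    exacts [hdisj i k h, (hdisj k i h).symm]
  calc _ ≤ P.real (⋃ k ∈ Finset.range (n + 1), A k) := measureReal_mono hsub (measure_ne_top _ _)
    _ ≤ ∑ k ∈ Finset.range (n + 1), P.real (A k) := measureReal_biUnion_finset_le _ _
    _ ≤ ∑ k ∈ Finset.range (n + 1), 2 * P.real (A k ∩ B k) := by
        refine Finset.sum_le_sum fun k hk => ?_
        rw [indep_first_passage hW hind]
        have h1 := hBprob k (Nat.lt_succ_iff.1 (Finset.mem_range.1 hk))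
        have h2 : 0 ≤ P.real (A k) := measureReal_nonneg
        nlinarith
    _ = 2 * P.real (⋃ k ∈ Finset.range (n + 1), A k ∩ B k) := by
        rw [← Finset.mul_sum, measureReal_biUnion_finset hdis fun k _ => (hA k).inter (hB k)]
    _ ≤ _ := by
        gcongr
        · exact measure_ne_top _ _
        refine Set.iUnion₂_subset fun k hk => ?_
        rintro ω ⟨⟨_, h1⟩, h2⟩
        have hk' : k ≤ n := Nat.lt_succ_iff.1 (Finset.mem_range.1 hk)
        have e := Finset.sum_range_add_sum_Ico (fun m => W m ω) hk'
        have h2' : |∑ m ∈ Finset.Ico k n, W m ω| ≤ x := h2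
        change x < |∑ m ∈ Finset.range n, W m ω|
        have h3 := abs_sub_abs_le_abs_sub (∑ m ∈ Finset.range k, W m ω)
          (-∑ m ∈ Finset.Ico k n, W m ω)
        rw [sub_neg_eq_add, e, abs_neg] at h3
        linarith

end Maximal

/-! ### Alternating sums of a stable random measure over consecutive intervals -/

section Levy

variable {Ω : Type*} [MeasurableSpace Ω] {P : Measure Ω} [IsProbabilityMeasure P] {α : ℝ}
  {M : Set ℝ → Ω → ℝ} {Z : ℝ → Ω → ℝ}

/-- The dyadic interval `(i/2^J, (i+1)/2^J]`. -/
def dyadicIoc (J i : ℕ) : Set ℝ := Set.Ioc ((i : ℝ) / 2 ^ J) (((i : ℝ) + 1) / 2 ^ J)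

lemma volume_real_dyadicIoc (J i : ℕ) : volume.real (dyadicIoc J i) = 1 / 2 ^ J := by
  rw [dyadicIoc, Real.volume_real_Ioc_of_le (by gcongr; linarith)]
  ring

/-- Intervals closed on the right match the ceiling, so a point determines its interval;
disjointness and the simple function `dyadicIndex` rely on this. -/
lemma mem_dyadicIoc_iff {J i : ℕ} {s : ℝ} :
    s ∈ dyadicIoc J i ↔ ⌈2 ^ J * s⌉₊ = i + 1 := by
  have hp : (0 : ℝ) < 2 ^ J := by positivity
  rw [Nat.ceil_eq_iff (Nat.succ_ne_zero i), dyadicIoc, Set.mem_Ioc, div_lt_iff₀' hp,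
    le_div_iff₀' hp]
  simp

lemma disjoint_dyadicIoc {J i k : ℕ} (h : i ≠ k) : Disjoint (dyadicIoc J i) (dyadicIoc J k) := by
  rw [Set.disjoint_left]
  intro s hi hk
  rw [mem_dyadicIoc_iff] at hi hk
  omega

lemma IsLevyProcessOf.ae_zero (hα : 0 < α) (hM : IsSaSRandomMeasure P α M)
    (hZ : IsLevyProcessOf P M Z) : ∀ᵐ ω ∂P, Z 0 ω = 0 := by
  filter_upwards [hM.ae_empty hα, hZ.eq_of_nonneg 0 le_rfl] with ω h1 h2
  rw [h2, Set.Ioc_self, h1]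

lemma IsLevyProcessOf.ae_increment (hα : 0 < α) (hM : IsSaSRandomMeasure P α M)
    (hZ : IsLevyProcessOf P M Z) : ∀ᵐ ω ∂P, ∀ J i : ℕ,
      Z (((i : ℝ) + 1) / 2 ^ J) ω - Z ((i : ℝ) / 2 ^ J) ω = M (dyadicIoc J i) ω := by
  rw [ae_all_iff]
  intro J
  rw [ae_all_iff]
  intro i
  have h0 : (0 : ℝ) ≤ (i : ℝ) / 2 ^ J := by positivity
  have h1 : (i : ℝ) / 2 ^ J ≤ ((i : ℝ) + 1) / 2 ^ J := by gcongr; linarith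
  filter_upwards [hZ.eq_of_nonneg _ h0, hZ.eq_of_nonneg _ (h0.trans h1),
    hM.ae_union hα (finBorel_Ioc 0 ((i : ℝ) / 2 ^ J))
      (finBorel_Ioc ((i : ℝ) / 2 ^ J) (((i : ℝ) + 1) / 2 ^ J))
      (Set.Ioc_disjoint_Ioc_of_le le_rfl)] with ω e1 e2 e3
  rw [Set.Ioc_union_Ioc_eq_Ioc h0 h1] at e3
  rw [e1, e2, e3, dyadicIoc]
  ring

/-- The sums `λ_{j,k}` as alternating sums of the random measure. -/
lemma IsLevyProcessOf.ae_lam_eq (hα : 0 < α) (hM : IsSaSRandomMeasure P α M)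
    (hZ : IsLevyProcessOf P M Z) : ∀ᵐ ω ∂P, ∀ j k : ℕ, lam α Z j k ω =
      (2 : ℝ) ^ ((j : ℝ) / α) *
        ∑ i ∈ Finset.range (2 * (k + 1)), (-1) ^ i * M (dyadicIoc (j + 1) i) ω := by
  filter_upwards [hZ.ae_increment hα hM] with ω hω j k
  rw [lam, sum_range_two_mul, Finset.mul_sum]
  refine Finset.sum_congr rfl fun m _ => ?_
  rw [← hω, ← hω, zeta]
  have e1 : ((2 * m : ℕ) : ℝ) / 2 ^ (j + 1) = m / 2 ^ j := by
    push_cast; rw [pow_succ']; field_simp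
  have e2 : (((2 * m : ℕ) : ℝ) + 1) / 2 ^ (j + 1) = (m + 1 / 2) / 2 ^ j := by
    push_cast; rw [pow_succ']; field_simp
  have e3 : ((2 * m + 1 : ℕ) : ℝ) / 2 ^ (j + 1) = (m + 1 / 2) / 2 ^ j := by
    push_cast; rw [pow_succ']; field_simp
  have e4 : (((2 * m + 1 : ℕ) : ℝ) + 1) / 2 ^ (j + 1) = (m + 1) / 2 ^ j := by
    push_cast; rw [pow_succ']; field_simp; ring
  rw [e1, e2, e3, e4, pow_succ, pow_mul]
  norm_num
  ring

lemma IsSaSRandomMeasure.prob_exists_abs_alternating_gt_le (hα : 0 < α) (hα₂ : α ≤ 2)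
    (hM : IsSaSRandomMeasure P α M) (J n : ℕ) {x : ℝ} (hx : 0 < x) :
    P.real {ω | ∃ k ≤ n, 2 * x < |∑ i ∈ Finset.range k, (-1) ^ i * M (dyadicIoc J i) ω|} ≤
      16 * (n / 2 ^ J) / x ^ α := by
  have hmeas : ∀ i, Measurable (M (dyadicIoc J i)) := fun i => hM.measurable _ (finBorel_Ioc _ _)
  have hind : iIndepFun (fun i ω => (-1) ^ i * M (dyadicIoc J i) ω) P := by
    have h : iIndepFun (fun i => M (dyadicIoc J i)) P :=
      iIndepFun_iff_finset.2 fun S => hM.iIndepFun_restrict (fun i _ => finBorel_Ioc _ _)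
        fun i _ k _ hik => disjoint_dyadicIoc hik
    exact h.comp (fun i y => (-1) ^ i * y) fun i => measurable_const_mul _
  have htail : ∀ k, P.real {ω | x < |∑ i ∈ Finset.Ico k n, (-1) ^ i * M (dyadicIoc J i) ω|} ≤
      8 * (n / 2 ^ J) / x ^ α := by
    intro k
    have h := hM.hasStableExponent_sum hα (S := Finset.Ico k n) (A := dyadicIoc J)
      (fun i => (-1) ^ i) (fun i _ => finBorel_Ioc _ _) fun i _ k _ hik => disjoint_dyadicIoc hik
    refine (h.prob_abs_gt_le hα hα₂ (by positivity) (Finset.measurable_fun_sum _ fun i _ =>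
      (hmeas i).const_mul _).aemeasurable hx).trans ?_
    gcongr
    simp only [abs_pow, abs_neg, abs_one, one_pow, Real.one_rpow, volume_real_dyadicIoc,
      Finset.sum_const, Nat.card_Ico, nsmul_eq_mul, mul_one_div]
    gcongr
    exact Nat.sub_le n k
  -- Ottaviani's inequality needs tails at most `1/2`; otherwise the claimed bound exceeds 1.
  by_cases hτ : 8 * (n / 2 ^ J) / x ^ α ≤ 1 / 2
  · have h1 := prob_exists_abs_sum_gt_le (P := P) (fun i => (hmeas i).const_mul ((-1) ^ i)) hind
      (fun k _ => (htail k).trans hτ)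
    have h2 := htail 0
    rw [← Finset.range_eq_Ico] at h2
    calc _ ≤ _ := h1
      _ ≤ 2 * (8 * (n / 2 ^ J) / x ^ α) := by gcongr
      _ = _ := by ring
  · calc _ ≤ (1 : ℝ) := measureReal_le_one
      _ ≤ 2 * (8 * (n / 2 ^ J) / x ^ α) := by linarith
      _ = _ := by ring

end Levy

/-! ### The good event has probability one -/

/-- The logarithm is at least 1, as `3 > e`, and at least `p log 2 > p/2`, whence the constant `1 +
2`. -/
lemma one_add_le_three_mul_log {p : ℕ} {y : ℝ} (hy : 0 ≤ y) (h : (2 : ℝ) ^ p ≤ 3 + y) :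
    (1 + p : ℝ) ≤ 3 * Real.log (3 + y) := by
  have h1 : (1 : ℝ) ≤ Real.log (3 + y) := by
    rw [Real.le_log_iff_exp_le (by linarith)]
    linarith [Real.exp_one_lt_d9]
  have h2 := Real.log_le_log (by positivity) h
  rw [Real.log_pow] at h2
  have h3 := Real.log_two_gt_d9
  have : (0 : ℝ) ≤ p := by positivity
  nlinarith

lemma summable_one_add_rpow_neg {q : ℝ} (hq : 1 < q) :
    Summable fun p : ℕ => (1 + p : ℝ) ^ (-q) := by
  have h : Summable fun n : ℕ => ((n + 1 : ℕ) : ℝ) ^ (-q) :=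
    (Real.summable_nat_rpow.2 (by linarith)).comp_injective (add_left_injective 1)
  refine h.congr fun p => ?_
  push_cast
  rw [add_comm]

/-- Cauchy condensation reduces the series to `∑ (1+k)^{-q}`. -/
lemma summable_one_div_mul_log_rpow {q : ℝ} (hq : 1 < q) :
    Summable fun j : ℕ => 1 / ((1 + j : ℝ) * Real.log (3 + j) ^ q) := by
  have hlog : ∀ n : ℕ, 0 < Real.log (3 + n) := fun n => by
    apply Real.log_pos
    have : (0 : ℝ) ≤ n := by positivity
    linarith
  refine (summable_condensed_iff_of_nonneg (fun n => ?_) fun m n _ hmn => ?_).1 ?_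
  · have := hlog n
    positivity
  · have := hlog m
    gcongr
  · refine Summable.of_nonneg_of_le (fun k => ?_) (fun k => ?_)
      ((summable_one_add_rpow_neg hq).mul_left (3 ^ q))
    · have := hlog (2 ^ k)
      positivity
    · have h0 := hlog (2 ^ k)
      have h1 := one_add_le_three_mul_log (p := k) (y := ((2 ^ k : ℕ) : ℝ)) (by positivity)
        (by push_cast; linarith)
      have h2 : (1 + k : ℝ) ^ q ≤ 3 ^ q * Real.log (3 + (2 ^ k : ℕ)) ^ q := by
        rw [← Real.mul_rpow (by norm_num) h0.le]
        gcongr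
      rw [Real.rpow_neg (by positivity), ← div_eq_mul_inv, mul_one_div,
        div_le_div_iff₀ (by positivity) (by positivity)]
      have h3 : (2 : ℝ) ^ k ≤ 1 + ((2 ^ k : ℕ) : ℝ) := by push_cast; linarith
      calc (2 : ℝ) ^ k * (1 + k : ℝ) ^ q ≤ (1 + ((2 ^ k : ℕ) : ℝ)) *
            (3 ^ q * Real.log (3 + (2 ^ k : ℕ)) ^ q) := by gcongr
        _ = _ := by ring

/-- The growth rate allowed for `λ_{j,k}`. -/
noncomputable def growthRate (α η : ℝ) (j k : ℕ) : ℝ :=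
  (1 + j : ℝ) ^ (1 / α) * Real.log (3 + j) ^ (1 / α + η) *
    ((1 + k : ℝ) ^ (1 / α) * Real.log (3 + k) ^ (1 / α + η))

lemma one_le_log_three_add (n : ℕ) : 1 ≤ Real.log (3 + n) := by
  have : (0 : ℝ) ≤ n := by positivity
  rw [Real.le_log_iff_exp_le (by linarith)]
  linarith [Real.exp_one_lt_d9]

lemma growthRate_nonneg (α η : ℝ) (j k : ℕ) : 0 ≤ growthRate α η j k := by
  have h1 := one_le_log_three_add j
  have h2 := one_le_log_three_add k
  unfold growthRate
  positivity

lemma growthRate_mono (α : ℝ) {η η' : ℝ} (h : η ≤ η') (j k : ℕ) :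
    growthRate α η j k ≤ growthRate α η' j k := by
  have h1 := one_le_log_three_add j
  have h2 := one_le_log_three_add k
  unfold growthRate
  gcongr

section GoodEvent

variable {Ω : Type*} {α : ℝ} {M : Set ℝ → Ω → ℝ} {Z : ℝ → Ω → ℝ}

/-- Countably many `η` and `C` suffice, since the rate is monotone in `η` (the logarithms are at
least 1); measurability follows from this form. -/
lemma mem_goodEvent_iff {ω : Ω} : ω ∈ goodEvent α Z ↔ ∀ n : ℕ, ∃ C : ℕ, ∀ j k : ℕ,
    |lam α Z j k ω| ≤ C * growthRate α (1 / (n + 1)) j k := by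
  constructor
  · intro h n
    obtain ⟨C, hC, hb⟩ := h (1 / (n + 1)) (by positivity)
    obtain ⟨N, hN⟩ := exists_nat_ge C
    refine ⟨N, fun j k => (hb j k).trans ?_⟩
    calc _ = C * growthRate α (1 / (n + 1)) j k := by
          unfold growthRate
          ring
      _ ≤ _ := mul_le_mul_of_nonneg_right hN (growthRate_nonneg _ _ _ _)
  · intro h η hη
    obtain ⟨n, hn⟩ := exists_nat_one_div_lt hη
    obtain ⟨C, hC⟩ := h n
    refine ⟨C + 1, by positivity, fun j k => (hC j k).trans ?_⟩
    calc C * growthRate α (1 / (n + 1)) j k ≤ (C + 1) * growthRate α η j k :=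
          mul_le_mul (by linarith) (growthRate_mono α hn.le j k) (growthRate_nonneg _ _ _ _)
            (by positivity)
      _ = _ := by
          unfold growthRate
          ring

variable [MeasurableSpace Ω] {P : Measure Ω}

lemma IsLevyProcessOf.measurable_lam (hZ : IsLevyProcessOf P M Z) (j k : ℕ) :
    Measurable (lam α Z j k) := by
  unfold lam
  refine Finset.measurable_fun_sum _ fun m _ => ?_
  unfold zeta
  exact (((hZ.measurable _).sub ((hZ.measurable _).const_mul 2)).add
    (hZ.measurable _)).const_mul _

lemma IsLevyProcessOf.measurableSet_goodEvent (hZ : IsLevyProcessOf P M Z) :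
    MeasurableSet (goodEvent α Z) := by
  have e : goodEvent α Z = ⋂ n : ℕ, ⋃ C : ℕ, ⋂ j : ℕ, ⋂ k : ℕ,
      {ω | |lam α Z j k ω| ≤ C * growthRate α (1 / (n + 1)) j k} := by
    ext ω
    rw [mem_goodEvent_iff]
    simp
  rw [e]
  exact MeasurableSet.iInter fun n => MeasurableSet.iUnion fun C => MeasurableSet.iInter fun j =>
    MeasurableSet.iInter fun k => measurableSet_le (hZ.measurable_lam j k).abs measurable_const

variable [IsProbabilityMeasure P]

/-- Probability that some `λ_{j,k}` with `2(k+1) ≤ 2^(p+2)` exceeds a threshold. -/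
lemma IsSaSRandomMeasure.prob_block_le (hα : 0 < α) (hα₂ : α ≤ 2)
    (hM : IsSaSRandomMeasure P α M) (j p : ℕ) {x : ℝ} (hx : 0 < x) :
    P.real {ω | ∃ k ≤ 2 ^ (p + 2), 2 * x < (2 : ℝ) ^ ((j : ℝ) / α) *
      |∑ i ∈ Finset.range k, (-1) ^ i * M (dyadicIoc (j + 1) i) ω|} ≤ 32 * 2 ^ p / x ^ α := by
  have hp : (0 : ℝ) < (2 : ℝ) ^ ((j : ℝ) / α) := by positivity
  have h := hM.prob_exists_abs_alternating_gt_le hα hα₂ (j + 1) (2 ^ (p + 2))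
    (div_pos hx hp)
  have e : {ω | ∃ k ≤ 2 ^ (p + 2), 2 * x < (2 : ℝ) ^ ((j : ℝ) / α) *
      |∑ i ∈ Finset.range k, (-1) ^ i * M (dyadicIoc (j + 1) i) ω|} =
      {ω | ∃ k ≤ 2 ^ (p + 2), 2 * (x / (2 : ℝ) ^ ((j : ℝ) / α)) <
        |∑ i ∈ Finset.range k, (-1) ^ i * M (dyadicIoc (j + 1) i) ω|} := by
    ext ω
    simp only [Set.mem_ofPred_eq, ← mul_div_assoc, div_lt_iff₀' hp]
  rw [e]
  -- The scaling `2^{j/α}`, raised to the power `α`, cancels the interval length up to a factor: `16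
  -- · 2^{p+2} / 2^{j+1} · 2^j = 32 · 2^p`.
  refine h.trans (le_of_eq ?_)
  rw [Real.div_rpow hx.le hp.le, ← Real.rpow_mul (by norm_num), div_mul_cancel₀ _ hα.ne',
    Real.rpow_natCast, pow_succ' 2 j]
  push_cast
  rw [pow_add 2 p]
  field_simp
  norm_num

/-- For each `η`, the growth estimate fails with probability at most a constant times `C^{-α}`. -/
lemma IsLevyProcessOf.prob_growth_le (hα : 0 < α) (hα₂ : α ≤ 2)
    (hM : IsSaSRandomMeasure P α M) (hZ : IsLevyProcessOf P M Z) {η : ℝ} (hη : 0 < η) :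
    ∃ K : ℝ, ∀ C : ℕ, P {ω | ¬ ∃ D : ℕ, ∀ j k : ℕ, |lam α Z j k ω| ≤ D * growthRate α η j k} ≤
      ENNReal.ofReal (K * (1 + C : ℝ) ^ (-α)) := by
  set r : ℝ := 1 / α + η with hr
  have hr0 : 0 < r := by positivity
  -- Here `α r = 1 + α η`: positivity of `η` is exactly what makes both series converge.
  have hq : 1 < α * r := by
    have : α * r = 1 + α * η := by rw [hr]; field_simp
    rw [this]
    nlinarith [mul_pos hα hη]
  have hsA := summable_one_div_mul_log_rpow hq
  have hsB := summable_one_add_rpow_neg hq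
  have hlog : ∀ n : ℕ, 0 < Real.log (3 + n) := fun n => one_pos.trans_le (one_le_log_three_add n)
  have hs : Summable fun jp : ℕ × ℕ =>
      1 / ((1 + jp.1 : ℝ) * Real.log (3 + jp.1) ^ (α * r)) * (1 + jp.2 : ℝ) ^ (-(α * r)) :=
    hsA.mul_of_nonneg hsB (fun j => by have := hlog j; positivity) (fun p => by positivity)
  set S := ∑' jp : ℕ × ℕ,
      1 / ((1 + jp.1 : ℝ) * Real.log (3 + jp.1) ^ (α * r)) * (1 + jp.2 : ℝ) ^ (-(α * r))
  refine ⟨32 * S, fun C => ?_⟩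
  -- In `x^α` the factor `2^p` cancels that of the block bound, leaving a product of summable terms
  -- in `j` and `p` times `(1+C)^{-α}`.
  let x : ℕ × ℕ → ℝ := fun jp => (1 + C : ℝ) *
    ((1 + jp.1 : ℝ) ^ (1 / α) * Real.log (3 + jp.1) ^ r) *
      (((2 : ℝ) ^ jp.2) ^ (1 / α) * (1 + jp.2 : ℝ) ^ r)
  have hx : ∀ jp, 0 < x jp := fun jp => by
    have := hlog jp.1
    positivity
  let E : ℕ × ℕ → Set Ω := fun jp => {ω | ∃ k ≤ 2 ^ (jp.2 + 2),
    2 * x jp < (2 : ℝ) ^ ((jp.1 : ℝ) / α) *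
      |∑ i ∈ Finset.range k, (-1) ^ i * M (dyadicIoc (jp.1 + 1) i) ω|}
  have hE : ∀ jp, P (E jp) ≤ ENNReal.ofReal (32 * (1 + C : ℝ) ^ (-α) *
      (1 / ((1 + jp.1 : ℝ) * Real.log (3 + jp.1) ^ (α * r)) * (1 + jp.2 : ℝ) ^ (-(α * r)))) := by
    intro jp
    have h := hM.prob_block_le hα hα₂ jp.1 jp.2 (hx jp)
    rw [← ofReal_measureReal (measure_ne_top P _)]
    refine ENNReal.ofReal_le_ofReal (h.trans (le_of_eq ?_))
    have hl := hlog jp.1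
    have ex : x jp ^ α = (1 + C : ℝ) ^ α * ((1 + jp.1 : ℝ) * Real.log (3 + jp.1) ^ (α * r)) *
        ((2 : ℝ) ^ jp.2 * (1 + jp.2 : ℝ) ^ (α * r)) := by
      simp only [x]
      rw [Real.mul_rpow (by positivity) (by positivity), Real.mul_rpow (by positivity)
        (by positivity), Real.mul_rpow (by positivity) (by positivity), Real.mul_rpow
        (by positivity) (by positivity), ← Real.rpow_mul (by positivity) (1 / α),
        ← Real.rpow_mul (by positivity) (1 / α), ← Real.rpow_mul (by positivity) r,
        ← Real.rpow_mul (by positivity) r, one_div_mul_cancel hα.ne', Real.rpow_one,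
        Real.rpow_one, mul_comm r]
    rw [ex, Real.rpow_neg (by positivity), Real.rpow_neg (by positivity)]
    field_simp
  have hsub : {ω | ¬ ∃ D : ℕ, ∀ j k : ℕ, |lam α Z j k ω| ≤ D * growthRate α η j k} ≤ᵐ[P]
      ⋃ jp, E jp := by
    filter_upwards [hZ.ae_lam_eq hα hM] with ω hω hbad
    by_contra hnot
    apply hbad
    have hnot' : ∀ jp, ω ∉ E jp := by
      intro jp hjp
      exact hnot (Set.mem_iUnion.2 ⟨jp, hjp⟩)
    -- `D` may depend on `C`, while the failure event does not mention `C`; the bound thus holds for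
    -- every `C` at once.
    obtain ⟨D, hD⟩ := exists_nat_ge (2 * (1 + C : ℝ) * 3 ^ r)
    refine ⟨D, fun j k => ?_⟩
    -- The dyadic block of `k + 1`: the alternating sum has `2(k+1) ≤ 2^{p+2}` terms.
    set p := Nat.log 2 (k + 1) with hp
    have hp1 : 2 ^ p ≤ k + 1 := Nat.pow_log_le_self 2 (Nat.succ_ne_zero k)
    have hp2 : k + 1 < 2 ^ (p + 1) := Nat.lt_pow_succ_log_self (by norm_num) _
    have h1 : |lam α Z j k ω| ≤ 2 * x (j, p) := by
      rw [hω, abs_mul, abs_of_pos (by positivity : (0 : ℝ) < (2 : ℝ) ^ ((j : ℝ) / α))]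
      by_contra hlt
      refine hnot' (j, p) ⟨2 * (k + 1), ?_, not_le.1 hlt⟩
      dsimp only
      rw [pow_succ 2 (p + 1)]
      omega
    have hp3 : (2 : ℝ) ^ p ≤ 1 + k := by
      have : ((2 ^ p : ℕ) : ℝ) ≤ ((k + 1 : ℕ) : ℝ) := by exact_mod_cast hp1
      push_cast at this
      linarith
    have hl := one_add_le_three_mul_log (p := p) (y := (k : ℝ)) (by positivity) (by linarith)
    have h2 : (1 + p : ℝ) ^ r ≤ 3 ^ r * Real.log (3 + k) ^ r := by
      rw [← Real.mul_rpow (by norm_num) (hlog k).le]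
      gcongr
    have hlj := hlog j
    have hlk := hlog k
    calc |lam α Z j k ω| ≤ 2 * x (j, p) := h1
      _ ≤ 2 * ((1 + C : ℝ) * ((1 + j : ℝ) ^ (1 / α) * Real.log (3 + j) ^ r) *
          ((1 + k : ℝ) ^ (1 / α) * (3 ^ r * Real.log (3 + k) ^ r))) := by
          simp only [x]
          gcongr
      _ = 2 * (1 + C : ℝ) * 3 ^ r * growthRate α η j k := by
          unfold growthRate
          ring
      _ ≤ D * growthRate α η j k :=
          mul_le_mul_of_nonneg_right hD (growthRate_nonneg _ _ _ _)
  calc _ ≤ P (⋃ jp, E jp) := measure_mono_ae hsub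
    _ ≤ ∑' jp, P (E jp) := measure_iUnion_le _
    _ ≤ ∑' jp : ℕ × ℕ, ENNReal.ofReal (32 * (1 + C : ℝ) ^ (-α) *
      (1 / ((1 + jp.1 : ℝ) * Real.log (3 + jp.1) ^ (α * r)) * (1 + jp.2 : ℝ) ^ (-(α * r)))) :=
        ENNReal.tsum_le_tsum hE
    _ = ENNReal.ofReal (32 * (1 + C : ℝ) ^ (-α) * S) := by
        rw [← ENNReal.ofReal_tsum_of_nonneg _ (hs.mul_left _), tsum_mul_left]
        intro jp
        have := hlog jp.1
        positivity
    _ = _ := by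
        congr 1
        ring

/-- Letting `C → ∞` makes each failure event null, and countably many `η` are enough. -/
lemma IsLevyProcessOf.prob_goodEvent (hα : 0 < α) (hα₂ : α ≤ 2)
    (hM : IsSaSRandomMeasure P α M) (hZ : IsLevyProcessOf P M Z) :
    P (goodEvent α Z) = 1 := by
  have hae : ∀ n : ℕ, ∀ᵐ ω ∂P, ∃ D : ℕ, ∀ j k : ℕ,
      |lam α Z j k ω| ≤ D * growthRate α (1 / (n + 1)) j k := by
    intro n
    obtain ⟨K, hK⟩ := hZ.prob_growth_le hα hα₂ hM (by positivity : (0 : ℝ) < 1 / (n + 1))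
    have ht : Tendsto (fun C : ℕ => (1 + C : ℝ) ^ (-α)) atTop (𝓝 0) :=
      (tendsto_rpow_neg_atTop hα).comp
        (tendsto_atTop_add_const_left _ _ tendsto_natCast_atTop_atTop)
    have ht' : Tendsto (fun C : ℕ => ENNReal.ofReal (K * (1 + C : ℝ) ^ (-α))) atTop (𝓝 0) := by
      have := ENNReal.tendsto_ofReal (ht.const_mul K)
      simpa using this
    exact le_antisymm (ge_of_tendsto' ht' hK) zero_le
  rw [← mem_ae_iff_prob_eq_one hZ.measurableSet_goodEvent]
  filter_upwards [ae_all_iff.2 hae] with ω hω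
  exact mem_goodEvent_iff.2 hω

end GoodEvent

/-! ### The step functions of the dyadic means -/

section Step

variable {α u v : ℝ}

/-- The index, shifted by one, of the dyadic interval of level `J` in `(0,1]` that contains `s`;
`0` off `(0,1]`. -/
noncomputable def dyadicIndex (J : ℕ) : SimpleFunc ℝ ℕ where
  toFun s := if s ∈ Set.Ioc (0 : ℝ) 1 then ⌈2 ^ J * s⌉₊ else 0
  measurableSet_fiber' y :=
    (Measurable.ite measurableSet_Ioc (Nat.measurable_ceil.comp (measurable_const_mul _))
      measurable_const) (measurableSet_singleton y)
  finite_range' := by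
    refine (Set.finite_Iic (2 ^ J)).subset ?_
    rintro _ ⟨s, rfl⟩
    dsimp only
    split_ifs with h
    · refine Nat.ceil_le.2 ?_
      push_cast
      have : (0 : ℝ) < 2 ^ J := by positivity
      nlinarith [h.2]
    · exact Nat.zero_le _

lemma dyadicIndex_apply (J : ℕ) (s : ℝ) :
    dyadicIndex J s = if s ∈ Set.Ioc (0 : ℝ) 1 then ⌈2 ^ J * s⌉₊ else 0 := rfl

lemma dyadicIoc_subset {J k : ℕ} (hk : k < 2 ^ J) : dyadicIoc J k ⊆ Set.Ioc 0 1 := by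
  intro s hs
  refine ⟨lt_of_le_of_lt (by positivity) hs.1, hs.2.trans ?_⟩
  rw [div_le_one (by positivity)]
  exact_mod_cast hk

lemma dyadicIndex_preimage {J k : ℕ} (hk : k < 2 ^ J) :
    dyadicIndex J ⁻¹' {k + 1} = dyadicIoc J k := by
  ext s
  rw [Set.mem_preimage, Set.mem_singleton_iff, mem_dyadicIoc_iff, dyadicIndex_apply]
  constructor
  · intro h
    split_ifs at h
    exact h
  · intro h
    rw [if_pos (dyadicIoc_subset hk (mem_dyadicIoc_iff.2 h)), h]

lemma dyadicIndex_range (J : ℕ) :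
    (dyadicIndex J).range.filter (fun y => y ≠ 0) = (Finset.range (2 ^ J)).image Nat.succ := by
  ext y
  simp only [Finset.mem_filter, SimpleFunc.mem_range, Set.mem_range, Finset.mem_image,
    Finset.mem_range]
  constructor
  · rintro ⟨⟨s, rfl⟩, h⟩
    rw [dyadicIndex_apply] at h ⊢
    split_ifs at h ⊢ with hs
    · refine ⟨⌈2 ^ J * s⌉₊ - 1, ?_, by omega⟩
      have : ⌈2 ^ J * s⌉₊ ≤ 2 ^ J := by
        refine Nat.ceil_le.2 ?_
        push_cast
        have : (0 : ℝ) < 2 ^ J := by positivity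
        nlinarith [hs.2]
      omega
    · exact absurd rfl h
  · rintro ⟨k, hk, rfl⟩
    refine ⟨⟨((k : ℝ) + 1) / 2 ^ J, ?_⟩, Nat.succ_ne_zero k⟩
    have : ((k : ℝ) + 1) / 2 ^ J ∈ dyadicIndex J ⁻¹' {k + 1} := by
      rw [dyadicIndex_preimage hk]
      exact ⟨by gcongr; linarith, le_rfl⟩
    exact this

lemma volume_dyadicIndex_preimage_lt_top (J : ℕ) (y : ℕ) (hy : y ≠ 0) :
    volume (dyadicIndex J ⁻¹' {y}) < ⊤ := by
  refine (measure_mono (t := Set.Ioc (0 : ℝ) 1) ?_).trans_lt measure_Ioc_lt_top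
  intro s hs
  by_contra h
  have h1 : dyadicIndex J s = y := hs
  rw [dyadicIndex_apply, if_neg h] at h1
  exact hy h1.symm

/-- The value of the step function on each dyadic interval. -/
noncomputable def stepValue (κ u : ℝ) (J y : ℕ) : ℝ :=
  if y = 0 then 0 else dyadicMean κ u J (y - 1)

/-- The step function of the dyadic means of `s ↦ (u-s)_+^κ` over `(0,1]`. -/
noncomputable def stepFunc (κ u : ℝ) (J : ℕ) : SimpleFunc ℝ ℝ :=
  (dyadicIndex J).map (stepValue κ u J)

lemma memLp_stepFunc (κ u : ℝ) (J : ℕ) (p : ENNReal) : MemLp (stepFunc κ u J) p volume := by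
  refine SimpleFunc.memLp_of_finite_measure_preimage p fun y hy => ?_
  refine (measure_mono (t := Set.Ioc (0 : ℝ) 1) ?_).trans_lt measure_Ioc_lt_top
  intro s hs
  by_contra h
  have h1 : stepValue κ u J (dyadicIndex J s) = y := hs
  rw [dyadicIndex_apply, if_neg h, stepValue, if_pos rfl] at h1
  exact hy h1.symm

/-- Beyond 1 the kernel vanishes because `u ≤ 1`. The point 0 is excluded because it lies in the
support convention of the kernel but not in `(0,1]`. -/
lemma abs_stepFunc_sub_highFreqKernel_le (hv : 1 / α < v) (hv' : v - 1 / α ≤ 1) (hu : u ≤ 1)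
    (J : ℕ) {s : ℝ} (hs : s ≠ 0) :
    |stepFunc (v - 1 / α) u J s - highFreqKernel α u v s| ≤
      Set.indicator (Set.Ioc (0 : ℝ) 1) (fun _ => ((1 : ℝ) / 2 ^ J) ^ (v - 1 / α)) s := by
  have e : stepFunc (v - 1 / α) u J s = stepValue (v - 1 / α) u J (dyadicIndex J s) := rfl
  by_cases h : s ∈ Set.Ioc (0 : ℝ) 1
  · have hc : 0 < ⌈2 ^ J * s⌉₊ := Nat.ceil_pos.2 (mul_pos (by positivity) h.1)
    rw [Set.indicator_of_mem h, e, dyadicIndex_apply, if_pos h, stepValue, if_neg hc.ne',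
      highFreqKernel, Set.indicator_of_mem (show s ∈ Set.Ici 0 from h.1.le)]
    refine abs_dyadicMean_sub_le (sub_pos.2 hv) hv' u ?_
    exact mem_dyadicIoc_iff.2 (by omega)
  · rw [Set.indicator_of_notMem h, e, dyadicIndex_apply, if_neg h, stepValue, if_pos rfl,
      highFreqKernel]
    by_cases h0 : s ∈ Set.Ici (0 : ℝ)
    · have h1 : 1 < s := by
        by_contra hle
        exact h ⟨lt_of_le_of_ne h0 hs.symm, not_lt.1 hle⟩
      rw [Set.indicator_of_mem h0, posPow_of_nonpos (by linarith)]
      simp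
    · rw [Set.indicator_of_notMem h0]
      simp

lemma memLp_highFreqKernel (hv : 1 / α < v) (hu : u ≤ 1) (p : ENNReal) :
    MemLp (highFreqKernel α u v) p volume := by
  have hκ : 0 < v - 1 / α := sub_pos.2 hv
  have hm : Measurable (highFreqKernel α u v) :=
    ((continuous_posPow hκ).comp (continuous_const.sub continuous_id)).measurable.indicator
      measurableSet_Ici
  refine (memLp_indicator_const p (measurableSet_Icc (a := (0 : ℝ)) (b := 1)) (1 : ℝ)
    (Or.inr measure_Icc_lt_top.ne)).mono hm.aestronglyMeasurable (ae_of_all _ fun s => ?_)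
  rw [highFreqKernel]
  by_cases h0 : s ∈ Set.Ici (0 : ℝ)
  · rw [Set.indicator_of_mem h0]
    have h0' : (0 : ℝ) ≤ s := h0
    by_cases h1 : s ≤ 1
    · rw [Set.indicator_of_mem (show s ∈ Set.Icc (0 : ℝ) 1 from ⟨h0, h1⟩),
        Real.norm_of_nonneg (posPow_nonneg _ _), norm_one]
      exact posPow_le_one hκ (by linarith)
    · rw [posPow_of_nonpos (by linarith), norm_zero]
      exact norm_nonneg _
  · rw [Set.indicator_of_notMem h0, norm_zero]
    exact norm_nonneg _

lemma tendsto_eLpNorm_stepFunc_sub (hv : 1 / α < v) (hv' : v - 1 / α ≤ 1) (hu : u ≤ 1)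
    {p : ENNReal} (hp : p ≠ 0) (hp' : p ≠ ⊤) :
    Tendsto (fun J => eLpNorm (fun s => stepFunc (v - 1 / α) u J s - highFreqKernel α u v s)
      p volume) atTop (𝓝 0) := by
  have hκ : 0 < v - 1 / α := sub_pos.2 hv
  have hle : ∀ J, eLpNorm (fun s => stepFunc (v - 1 / α) u J s - highFreqKernel α u v s) p volume
      ≤ ENNReal.ofReal (((1 : ℝ) / 2 ^ J) ^ (v - 1 / α)) := by
    intro J
    have h1 : eLpNorm (fun s => stepFunc (v - 1 / α) u J s - highFreqKernel α u v s) p volume ≤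
        eLpNorm (Set.indicator (Set.Ioc (0 : ℝ) 1)
          (fun _ => ((1 : ℝ) / 2 ^ J) ^ (v - 1 / α))) p volume := by
      refine eLpNorm_mono_ae_real ?_
      filter_upwards [(measure_singleton (0 : ℝ) : volume {(0 : ℝ)} = 0) |>
        compl_mem_ae_iff.2] with s hs
      exact abs_stepFunc_sub_highFreqKernel_le hv hv' hu J hs
    refine h1.trans ?_
    rw [eLpNorm_indicator_const measurableSet_Ioc hp hp', Real.volume_Ioc, sub_zero,
      ENNReal.ofReal_one, ENNReal.one_rpow, mul_one, Real.enorm_eq_ofReal (by positivity)]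
  have h2 : Tendsto (fun J : ℕ => ((1 : ℝ) / 2 ^ J) ^ (v - 1 / α)) atTop (𝓝 0) := by
    have h3 : Tendsto (fun J : ℕ => (1 : ℝ) / 2 ^ J) atTop (𝓝 0) := by
      have := tendsto_pow_atTop_nhds_zero_of_lt_one (r := (1 / 2 : ℝ)) (by norm_num) (by norm_num)
      simpa [one_div, inv_pow] using this
    have := h3.rpow_const (p := v - 1 / α) (Or.inr hκ.le)
    rwa [Real.zero_rpow hκ.ne'] at this
  have h4 := ENNReal.tendsto_ofReal h2
  rw [ENNReal.ofReal_zero] at h4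
  exact tendsto_of_tendsto_of_tendsto_of_le_of_le tendsto_const_nhds h4 (fun _ => zero_le) hle

end Step

/-! ### The limit field -/

section Field

variable {Ω : Type*} [MeasurableSpace Ω] {P : Measure Ω} {α : ℝ} {M : Set ℝ → Ω → ℝ}
  {Z : ℝ → Ω → ℝ}

lemma IsLevyProcessOf.measurable_partialSum (hZ : IsLevyProcessOf P M Z) (J : ℕ) (u v : ℝ) :
    Measurable (partialSum α Z J u v) := by
  unfold partialSum
  refine ((hZ.measurable _).const_mul _).add (Finset.measurable_fun_sum _ fun j _ =>
    (Finset.measurable_fun_sum _ fun k _ => Measurable.mul_const ?_ _).const_mul _)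
  unfold zeta
  exact (((hZ.measurable _).sub ((hZ.measurable _).const_mul 2)).add
    (hZ.measurable _)).const_mul _

variable [IsProbabilityMeasure P]

lemma IsLevyProcessOf.ae_partialSum_eq (hα : 0 < α) (hM : IsSaSRandomMeasure P α M)
    (hZ : IsLevyProcessOf P M Z) (J : ℕ) : ∀ᵐ ω ∂P, ∀ u v : ℝ, 1 / α < v → 0 ≤ u → u ≤ 1 →
      partialSum α Z J u v ω = ∑ k ∈ Finset.range (2 ^ J),
        dyadicMean (v - 1 / α) u J k * M (dyadicIoc J k) ω := by
  filter_upwards [hZ.ae_zero hα hM, hZ.ae_increment hα hM] with ω h0 h1 u v hv hu hu'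
  rw [partialSum_eq_sum_dyadicMean hv hu hu' Z ω h0]
  simp only [h1]

lemma IsSaSRandomMeasure.ae_simpleIntegral_stepFunc (hα : 0 < α) (hM : IsSaSRandomMeasure P α M)
    (κ u : ℝ) (J : ℕ) : ∀ᵐ ω ∂P, simpleIntegral M (stepFunc κ u J) ω =
      ∑ k ∈ Finset.range (2 ^ J), dyadicMean κ u J k * M (dyadicIoc J k) ω := by
  filter_upwards [hM.ae_simpleIntegral_map hα (dyadicIndex J)
    (volume_dyadicIndex_preimage_lt_top J) (stepValue κ u J) (if_pos rfl)] with ω hω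
  rw [stepFunc, hω, dyadicIndex_range, Finset.sum_image fun _ _ _ _ h => Nat.succ_injective h]
  refine Finset.sum_congr rfl fun k hk => ?_
  rw [Nat.succ_eq_add_one, dyadicIndex_preimage (Finset.mem_range.1 hk), stepValue,
    if_neg (Nat.succ_ne_zero k), Nat.add_sub_cancel]

/-- A limit of the Haar partial sums is a version of the stable integral of the high frequency
kernel. -/
lemma IsLevyProcessOf.isStableIntegral (hα : 1 ≤ α) (hα₂ : α ≤ 2)
    (hM : IsSaSRandomMeasure P α M) (hZ : IsLevyProcessOf P M Z) {u v : ℝ} (hv : 1 / α < v)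
    (hv' : v - 1 / α ≤ 1) (hu : 0 ≤ u) (hu' : u ≤ 1) {Y : Ω → ℝ} (hY : Measurable Y)
    (hlim : ∀ᵐ ω ∂P, Tendsto (fun J => partialSum α Z J u v ω) atTop (𝓝 (Y ω))) :
    IsStableIntegral P α M (highFreqKernel α u v) Y := by
  have hα0 : 0 < α := by linarith
  have hp1 : (1 : ENNReal) ≤ ENNReal.ofReal α := by simpa using hα
  have hp0 : ENNReal.ofReal α ≠ 0 := by simpa using hα0
  have hf := memLp_highFreqKernel hv hu' (ENNReal.ofReal α)
  refine ⟨hf, hY.aemeasurable, fun g hg hgf => ?_⟩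
  have hh := fun J => memLp_stepFunc (v - 1 / α) u J (ENNReal.ofReal α)
  set N : ℕ → ℝ := fun n =>
    (eLpNorm (fun s => g n s - highFreqKernel α u v s) (ENNReal.ofReal α) volume).toReal with hN
  set δ : ℕ → ℝ := fun J => (eLpNorm (fun s => stepFunc (v - 1 / α) u J s -
    highFreqKernel α u v s) (ENNReal.ofReal α) volume).toReal with hδ
  have hδ0 : Tendsto δ atTop (𝓝 0) := by
    have := (ENNReal.tendsto_toReal ENNReal.zero_ne_top).comp
      (tendsto_eLpNorm_stepFunc_sub hv hv' hu' hp0 ENNReal.ofReal_ne_top)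
    rwa [ENNReal.toReal_zero] at this
  have hN0 : Tendsto N atTop (𝓝 0) := by
    have := (ENNReal.tendsto_toReal ENNReal.zero_ne_top).comp hgf
    rwa [ENNReal.toReal_zero] at this
  -- Minkowski's inequality, which requires `α ≥ 1`.
  have htri : ∀ n J, (eLpNorm (fun s => g n s - stepFunc (v - 1 / α) u J s)
      (ENNReal.ofReal α) volume).toReal ≤ N n + δ J := by
    intro n J
    have h1 : MemLp (fun s => g n s - highFreqKernel α u v s) (ENNReal.ofReal α) volume :=
      (hg n).sub hf
    have h2 : MemLp (fun s => stepFunc (v - 1 / α) u J s - highFreqKernel α u v s)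
      (ENNReal.ofReal α) volume := (hh J).sub hf
    have h3 := eLpNorm_sub_le h1.1 h2.1 hp1
    have e : (fun s => g n s - highFreqKernel α u v s) -
        (fun s => stepFunc (v - 1 / α) u J s - highFreqKernel α u v s) =
        fun s => g n s - stepFunc (v - 1 / α) u J s := by
      funext s
      simp
    rw [e] at h3
    have h4 := ENNReal.toReal_mono (ENNReal.add_ne_top.2 ⟨h1.2.ne, h2.2.ne⟩) h3
    rwa [ENNReal.toReal_add h1.2.ne h2.2.ne] at h4
  have hconv := tendstoInMeasure_of_tendsto_ae
    (fun J => (hZ.measurable_partialSum (α := α) J u v).aestronglyMeasurable) hlim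
  rw [tendstoInMeasure_iff_measureReal_norm] at hconv ⊢
  intro ε hε
  have hε3 : 0 < ε / 3 := by positivity
  -- The Haar sum, almost surely the integral of the step function, is an intermediary between the
  -- integral of `g n` and `Y`. Sending `J → ∞` first leaves a bound in the `L^α` distance from `g
  -- n` to the kernel.
  have hbound : ∀ n, P.real {ω | ε ≤ ‖simpleIntegral M (g n) ω - Y ω‖} ≤
      8 * N n ^ α / (ε / 3) ^ α := by
    intro n
    have hJ : ∀ J, P.real {ω | ε ≤ ‖simpleIntegral M (g n) ω - Y ω‖} ≤
        8 * (N n + δ J) ^ α / (ε / 3) ^ α +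
          P.real {ω | ε / 3 ≤ ‖partialSum α Z J u v ω - Y ω‖} := by
      intro J
      have h1 := hM.prob_abs_simpleIntegral_sub_gt_le hα0 hα₂ (hg n) (hh J) hε3
      have hsub : {ω | ε ≤ ‖simpleIntegral M (g n) ω - Y ω‖} ≤ᵐ[P]
          ({ω | ε / 3 < |simpleIntegral M (g n) ω -
            simpleIntegral M (stepFunc (v - 1 / α) u J) ω|} ∪
          {ω | ε / 3 ≤ ‖partialSum α Z J u v ω - Y ω‖} : Set Ω) := by
        filter_upwards [hZ.ae_partialSum_eq hα0 hM J,
          hM.ae_simpleIntegral_stepFunc hα0 (v - 1 / α) u J] with ω e1 e2 hω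
        have e3 := (e1 u v hv hu hu').trans e2.symm
        have hω' : ε ≤ ‖simpleIntegral M (g n) ω - Y ω‖ := hω
        change ω ∈ ({ω | ε / 3 < |simpleIntegral M (g n) ω -
            simpleIntegral M (stepFunc (v - 1 / α) u J) ω|} ∪
          {ω | ε / 3 ≤ ‖partialSum α Z J u v ω - Y ω‖} : Set Ω)
        by_contra hcon
        rw [Set.mem_union, not_or, Set.mem_ofPred_eq, Set.mem_ofPred_eq, not_lt, not_le, ← e3,
          Real.norm_eq_abs] at hcon
        rw [Real.norm_eq_abs] at hω'
        have := abs_sub_le (simpleIntegral M (g n) ω) (partialSum α Z J u v ω) (Y ω)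
        linarith [hcon.1, hcon.2]
      calc _ ≤ P.real (_ ∪ _) :=
            ENNReal.toReal_mono (measure_ne_top _ _) (measure_mono_ae hsub)
        _ ≤ _ + _ := measureReal_union_le _ _
        _ ≤ _ := by
            gcongr
            refine h1.trans ?_
            gcongr
            exact htri n J
    have hlimJ : Tendsto (fun J => 8 * (N n + δ J) ^ α / (ε / 3) ^ α +
        P.real {ω | ε / 3 ≤ ‖partialSum α Z J u v ω - Y ω‖}) atTop
        (𝓝 (8 * (N n + 0) ^ α / (ε / 3) ^ α + 0)) :=
      (((((tendsto_const_nhds.add hδ0).rpow_const (Or.inr hα0.le)).const_mul 8).div_const _)).add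
        (hconv _ hε3)
    rw [add_zero, add_zero] at hlimJ
    exact ge_of_tendsto' hlimJ hJ
  have hfinal : Tendsto (fun n => 8 * N n ^ α / (ε / 3) ^ α) atTop (𝓝 0) := by
    have := ((hN0.rpow_const (p := α) (Or.inr hα0.le)).const_mul 8).div_const ((ε / 3) ^ α)
    simpa [Real.zero_rpow hα0.ne'] using this
  exact tendsto_of_tendsto_of_tendsto_of_le_of_le tendsto_const_nhds hfinal
    (fun _ => measureReal_nonneg) hbound

lemma tendsto_charFun_map_of_tendsto_ae {V : ℕ → Ω → ℝ} {Y : Ω → ℝ} (hV : ∀ J, Measurable (V J))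
    (hY : Measurable Y) (h : ∀ᵐ ω ∂P, Tendsto (fun J => V J ω) atTop (𝓝 (Y ω))) (t : ℝ) :
    Tendsto (fun J => charFun (P.map (V J)) t) atTop (𝓝 (charFun (P.map Y) t)) := by
  have e : ∀ X : Ω → ℝ, Measurable X →
      charFun (P.map X) t = ∫ ω, Complex.exp (t * X ω * Complex.I) ∂P := by
    intro X hX
    rw [charFun_apply_real, integral_map hX.aemeasurable]
    exact (by fun_prop : Continuous fun x : ℝ =>
      Complex.exp (t * x * Complex.I)).aestronglyMeasurable
  simp only [e _ (hV _), e _ hY]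
  refine tendsto_integral_of_dominated_convergence (fun _ => 1) (fun J => ?_)
    (integrable_const _) (fun J => ae_of_all _ fun ω => ?_) ?_
  · have := hV J
    exact (by fun_prop : Measurable fun ω =>
      Complex.exp (t * V J ω * Complex.I)).aestronglyMeasurable
  · rw [← Complex.ofReal_mul, Complex.norm_exp_ofReal_mul_I]
  · filter_upwards [h] with ω hω
    exact ((by fun_prop : Continuous fun x : ℝ =>
      Complex.exp (t * x * Complex.I)).tendsto _).comp hω

/-- Limits of linear combinations of Haar partial sums are symmetric stable. -/
lemma IsLevyProcessOf.exists_isSaS_sum (hα : 0 < α) (hM : IsSaSRandomMeasure P α M)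
    (hZ : IsLevyProcessOf P M Z) {n : ℕ} {u v : Fin n → ℝ} (hv : ∀ i, 1 / α < v i)
    (hu : ∀ i, 0 ≤ u i) (hu' : ∀ i, u i ≤ 1) {Y : Fin n → Ω → ℝ} (hY : ∀ i, Measurable (Y i))
    (hlim : ∀ i, ∀ᵐ ω ∂P, Tendsto (fun J => partialSum α Z J (u i) (v i) ω) atTop (𝓝 (Y i ω)))
    (c : Fin n → ℝ) :
    ∃ σ : ℝ, 0 ≤ σ ∧ IsSaS α σ (P.map (fun ω => ∑ i, c i * Y i ω)) := by
  set d : ℕ → ℕ → ℝ := fun J k => ∑ i, c i * dyadicMean (v i - 1 / α) (u i) J k with hd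
  set s : ℕ → ℝ := fun J => ∑ k ∈ Finset.range (2 ^ J), |d J k| ^ α * volume.real (dyadicIoc J k)
    with hs
  have hexp : ∀ J, HasStableExponent α (s J)
      (P.map fun ω => ∑ i, c i * partialSum α Z J (u i) (v i) ω) := by
    intro J
    have h := hM.hasStableExponent_sum hα (S := Finset.range (2 ^ J)) (A := dyadicIoc J) (d J)
      (fun i _ => finBorel_Ioc _ _) fun i _ k _ hik => disjoint_dyadicIoc hik
    have e : (fun ω => ∑ i, c i * partialSum α Z J (u i) (v i) ω) =ᵐ[P]
        fun ω => ∑ k ∈ Finset.range (2 ^ J), d J k * M (dyadicIoc J k) ω := by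
      filter_upwards [hZ.ae_partialSum_eq hα hM J] with ω hω
      simp only [hω _ _ (hv _) (hu _) (hu' _), Finset.mul_sum, hd, Finset.sum_mul]
      rw [Finset.sum_comm]
      exact Finset.sum_congr rfl fun k _ => Finset.sum_congr rfl fun i _ => by ring
    rw [Measure.map_congr e]
    exact h
  have hs_mem : ∀ J, s J ∈ Set.Icc 0 ((∑ i, |c i|) ^ α) := by
    intro J
    have hdb : ∀ k, |d J k| ≤ ∑ i, |c i| := by
      intro k
      refine (Finset.abs_sum_le_sum_abs _ _).trans (Finset.sum_le_sum fun i _ => ?_)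
      rw [abs_mul]
      exact mul_le_of_le_one_right (abs_nonneg _)
        (abs_dyadicMean_le_one (sub_pos.2 (hv i)) (hu' i) J k)
    refine ⟨Finset.sum_nonneg fun k _ => by positivity, ?_⟩
    calc s J ≤ ∑ k ∈ Finset.range (2 ^ J), (∑ i, |c i|) ^ α * (1 / 2 ^ J) := by
          refine Finset.sum_le_sum fun k _ => ?_
          rw [volume_real_dyadicIoc]
          gcongr
          exact hdb k
      _ = _ := by
          simp
          field_simp
  -- A subsequence suffices: the characteristic functions already converge to that of the limit. The
  -- exponents are bounded as the means are at most 1 and the lengths add up to 1.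
  obtain ⟨s₀, hs₀, φ, hφ, hφs⟩ := isCompact_Icc.tendsto_subseq hs_mem
  have hVm : ∀ J, Measurable fun ω => ∑ i, c i * partialSum α Z J (u i) (v i) ω := fun J =>
    Finset.measurable_fun_sum _ fun i _ => (hZ.measurable_partialSum J _ _).const_mul _
  have hYm : Measurable fun ω => ∑ i, c i * Y i ω :=
    Finset.measurable_fun_sum _ fun i _ => (hY i).const_mul _
  have hVlim : ∀ᵐ ω ∂P, Tendsto (fun J => ∑ i, c i * partialSum α Z J (u i) (v i) ω) atTop
      (𝓝 (∑ i, c i * Y i ω)) := by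
    filter_upwards [ae_all_iff.2 hlim] with ω hω
    exact tendsto_finsetSum _ fun i _ => (hω i).const_mul _
  refine ⟨s₀ ^ (1 / α), Real.rpow_nonneg hs₀.1 _, fun t => ?_⟩
  rw [← Real.rpow_mul hs₀.1, one_div_mul_cancel hα.ne', Real.rpow_one]
  have h1 := (tendsto_charFun_map_of_tendsto_ae hVm hYm hVlim t).comp hφ.tendsto_atTop
  have h2 : Tendsto (fun J => Complex.exp (-((s (φ J) * |t| ^ α : ℝ) : ℂ))) atTop
      (𝓝 (Complex.exp (-((s₀ * |t| ^ α : ℝ) : ℂ)))) :=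
    ((by fun_prop : Continuous fun x : ℝ =>
      Complex.exp (-((x * |t| ^ α : ℝ) : ℂ))).tendsto s₀).comp hφs
  exact tendsto_nhds_unique h1 (h2.congr fun J => (hexp (φ J) t).symm)

end Field

end HaarLMSM

/-! ### Assembly of the theorem -/

theorem theorem1 {Ω : Type*} [MeasurableSpace Ω] (P : Measure Ω) [IsProbabilityMeasure P]
    (α : ℝ) (hα₁ : 1 < α) (hα₂ : α < 2)
    (M : Set ℝ → Ω → ℝ) (hM : HaarLMSM.IsSaSRandomMeasure P α M)
    (Z : ℝ → Ω → ℝ) (hZ : HaarLMSM.IsLevyProcessOf P M Z) :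
    MeasurableSet (HaarLMSM.goodEvent α Z) ∧ P (HaarLMSM.goodEvent α Z) = 1 ∧
    ∀ a b : ℝ, 1 / α < a → a < b → b < 1 →
      ∃ (XJ : ℕ → Ω → C(HaarLMSM.Rect a b, ℝ)) (X₁ : Ω → C(HaarLMSM.Rect a b, ℝ)),
        (∀ J ω p, XJ J ω p = HaarLMSM.partialSum α Z J p.1 p.2 ω) ∧
        (∀ ω ∈ HaarLMSM.goodEvent α Z,
          Tendsto (fun J => XJ J ω) atTop (𝓝 (X₁ ω)) ∧
          ∀ η : ℝ, 0 < η →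
            (fun J : ℕ => ‖X₁ ω - XJ J ω‖) =O[atTop]
              (fun J : ℕ => (2 : ℝ) ^ (-(J : ℝ) * (a - 1 / α)) * (J : ℝ) ^ (2 / α + η))) ∧
        HaarLMSM.IsSaSField P α (fun p ω => X₁ ω p) ∧
        (∀ p : HaarLMSM.Rect a b, HaarLMSM.IsStableIntegral P α M
          (HaarLMSM.highFreqKernel α p.1 p.2) (fun ω => X₁ ω p)) := by
  have hα0 : 0 < α := by linarith
  have hGm : MeasurableSet (HaarLMSM.goodEvent α Z) := hZ.measurableSet_goodEvent
  have hG1 : P (HaarLMSM.goodEvent α Z) = 1 := hZ.prob_goodEvent hα0 hα₂.le hM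
  refine ⟨hGm, hG1, fun a b ha _ hb => ?_⟩
  -- Setting the limit to 0 off the good event makes each value an everywhere limit of measurable
  -- functions, the partial sums cut off by the indicator of that event.
  have hex : ∀ ω, ∃ X : C(HaarLMSM.Rect a b, ℝ),
      (ω ∈ HaarLMSM.goodEvent α Z →
        Tendsto (fun J => HaarLMSM.partialSumMap ha b Z J ω) atTop (𝓝 X)) ∧
      (ω ∉ HaarLMSM.goodEvent α Z → X = 0) := by
    intro ω
    by_cases hω : ω ∈ HaarLMSM.goodEvent α Z
    · obtain ⟨X, hX⟩ := HaarLMSM.exists_tendsto_partialSumMap hα₁ ha hb hω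
      exact ⟨X, fun _ => hX, fun h => absurd hω h⟩
    · exact ⟨0, fun h => absurd h hω, fun _ => rfl⟩
  choose X₁ hX₁ hX₁' using hex
  have hpt : ∀ ω ∈ HaarLMSM.goodEvent α Z, ∀ p : HaarLMSM.Rect a b,
      Tendsto (fun J => HaarLMSM.partialSum α Z J p.1 p.2 ω) atTop (𝓝 (X₁ ω p)) := fun ω hω p =>
    ((continuous_eval_const p).tendsto _).comp (hX₁ ω hω)
  have hmeas : ∀ p : HaarLMSM.Rect a b, Measurable fun ω => X₁ ω p := by
    intro p
    refine measurable_of_tendsto_metrizable (f := fun J =>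
      (HaarLMSM.goodEvent α Z).indicator (HaarLMSM.partialSum α Z J p.1 p.2))
      (fun J => (hZ.measurable_partialSum J _ _).indicator hGm) (tendsto_pi_nhds.2 fun ω => ?_)
    by_cases hω : ω ∈ HaarLMSM.goodEvent α Z
    · simp only [Set.indicator_of_mem hω]
      exact hpt ω hω p
    · simp only [Set.indicator_of_notMem hω, hX₁' ω hω]
      exact tendsto_const_nhds
  have hae : ∀ p : HaarLMSM.Rect a b, ∀ᵐ ω ∂P,
      Tendsto (fun J => HaarLMSM.partialSum α Z J p.1 p.2 ω) atTop (𝓝 (X₁ ω p)) := by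
    intro p
    filter_upwards [(mem_ae_iff_prob_eq_one hGm).2 hG1] with ω hω
    exact hpt ω hω p
  have hv : ∀ p : HaarLMSM.Rect a b, 1 / α < (p.2 : ℝ) := fun p => ha.trans_le p.2.2.1
  have hv' : ∀ p : HaarLMSM.Rect a b, (p.2 : ℝ) - 1 / α ≤ 1 := fun p => by
    have : 0 < 1 / α := by positivity
    linarith [p.2.2.2]
  refine ⟨fun J ω => HaarLMSM.partialSumMap ha b Z J ω, X₁, fun J ω p => rfl,
    fun ω hω => ⟨hX₁ ω hω, fun η hη =>
      HaarLMSM.isBigO_sub_partialSumMap hα₁ ha hb hω (hX₁ ω hω) hη⟩,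
    ⟨hmeas, fun n p c => ?_⟩, fun p => ?_⟩
  · exact hZ.exists_isSaS_sum hα0 hM (fun i => hv (p i)) (fun i => (p i).1.2.1)
      (fun i => (p i).1.2.2) (fun i => hmeas (p i)) (fun i => hae (p i)) c
  · exact hZ.isStableIntegral hα₁.le hα₂.le hM (hv p) (hv' p) p.1.2.1 p.1.2.2 (hmeas p) (hae p)
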